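/- Fix a commutative ring $\kappa$. "Algebra" means commutative associative $\kappa$-algebra, not necessarily with an identity element; algebra maps are $\kappa$-linear and multiplicative. An action of an algebra $R$ on an algebra $M$ is a $\kappa$-bilinear map $(r,m)\mapsto r\blacktriangleright m$ with $r\blacktriangleright(mm')=(r\blacktriangleright m)m'$ and $(rr')\blacktriangleright m=r\blacktriangleright(r'\blacktriangleright m)$; it defines the algebra $R\ltimes M$ with product $(r,m)(r',m')=(rr',\,r\blacktriangleright m'+r'\blacktriangleright m+mm')$. **2-crossed modules.** A 2-crossed module $\mathcal A=(L\xrightarrow{\partial_2}E\xrightarrow{\partial_1}R)$ consists of algebra maps with $\partial_1\partial_2=0$, actions $\blacktriangleright$ of $R$ on $E$ and on $L$ with $\partial_1(r\blacktriangleright e)=r\,\partial_1(e)$ and $\partial_2(r\blacktriangleright l)=r\blacktriangleright\partial_2(l)$, and a $\kappa$-bilinear map $\{\,\otimes\,\}:E\times E\to L$ such that, with $e\blacktriangleright' l:=\{e\otimes\partial_2 l\}$, $\partial_2\{e\otimes e'\}=ee'-\partial_1(e')\blacktriangleright e$; $\{\partial_2 l\otimes\partial_2 l'\}=ll'$; $\{e\otimes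 e'e''\}=\{ee'\otimes e''\}+\partial_1(e'')\blacktriangleright\{e\otimes e'\}$; $\{\partial_2 l\otimes e\}=e\blacktriangleright' l-\partial_1(e)\blacktriangleright l$; $r\blacktriangleright\{e\otimes e'\}=\{r\blacktriangleright e\otimes e'\}=\{e\otimes r\blacktriangleright e'\}$. A map $f=(f_2,f_1,f_0):\mathcal A\to\mathcal A'$ is a triple of algebra maps commuting with $\partial_1,\partial_2$ and preserving the actions and $\{\,\otimes\,\}$. Let $\mathcal A,\mathcal A'$ be 2-crossed modules, where $\mathcal A$ is free up to order one with a chosen basis $B$: $R$ is identified with the polynomial algebra $\kappa[B]$, or with the algebra of polynomials over $\kappa$ in the variables $B$ without constant term (the free algebra on $B$ when identity elements are not required). **Homotopies.** An $f_0$-derivation is a $\kappa$-linear map $s:R\to E'$ with $s(rr')=f_0(r)\blacktriangleright s(r')+f_0(r')\blacktriangleright s(r)+s(r)s(r')$, and with $s(1)=0$ if $R$ has an identity element $1$. A quadratic $f$-derivation is a pair $(s,t)$ of an $f_0$-derivation $s$ and a $\kappa$-linear map $t:E\to L'$ with $$\begin{aligned}t(ee')={}&\{s\partial_1e\otimes f_1e'\}+\{s\partial_1e'\otimes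 f_1e\}+f_1e\blacktriangleright' te'+f_1e'\blacktriangleright' te+s\partial_1e\blacktriangleright' te'+s\partial_1e'\blacktriangleright' te+te\,te',\\ t(r\blacktriangleright e)={}&f_0r\blacktriangleright te+\partial_1'sr\blacktriangleright te+\{sr\otimes f_1e\}-\{f_1e\otimes sr\}-\{s\partial_1e\otimes sr\}.\end{aligned}$$ It is a homotopy $f\to g$ if $g_0=f_0+\partial_1's$, $g_1=f_1+s\partial_1+\partial_2't$ and $g_2=f_2+t\partial_2$. For homotopies $(s,t):f\to g$ and $(u,v):g\to k$, let $s\boxplus u$ be the unique $f_0$-derivation which agrees with $s+u$ on $B$. Let $\mathcal A'_2=(R'\ltimes E')\ltimes(E'\ltimes_{\blacktriangleright'}L')$ be the algebra of 2-simplices of $\mathcal A'$, formed with the action $(r,e)\blacktriangleright(e',l)=(ee'+r\blacktriangleright e',\ \partial_1'(e)\blacktriangleright l+r\blacktriangleright l-\{e'\otimes e\})$. Let $w^{(s,u)}:R\to L'$ be the unique linear map which vanishes on $B$ (and at $1$, if $R$ has an identity element) and for which $r\mapsto\big(f_0r,\ sr,\ ur-\partial_2'w^{(s,u)}r,\ w^{(s,u)}r\big)$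 is an algebra map $R\to\mathcal A'_2$. Put $t\boxplus v=t+v+w^{(s,u)}\partial_1$. The groupoid $\mathrm{HOM}(\mathcal A,\mathcal A')$ has the 2-crossed module maps $\mathcal A\to\mathcal A'$ as objects and the homotopies as arrows; its composition is $(s,t)\boxplus(u,v)=(s\boxplus u,t\boxplus v):f\to k$ and its identities are $(0,0)$. **2-fold homotopies.** Let $(s,t):f\to g$ be a homotopy. A quadratic $(f,s,t)$-2-derivation is a $\kappa$-linear map $q:R\to L'$ with $$q(rr')=f_0r\blacktriangleright qr'+f_0r'\blacktriangleright qr+sr\blacktriangleright' qr'+sr'\blacktriangleright' qr+qr\,qr',$$ and with $q(1)=0$ if $R$ has an identity element. It is a 2-fold homotopy $(s,t)\Rightarrow(s',t')$ if $s'=s+\partial_2'q$ and $t'=t-q\partial_1$. The groupoid $\mathrm{HOM}_2(\mathcal A,\mathcal A',f,g)$ has the homotopies $f\to g$ as objects and the 2-fold homotopies as arrows, with composition $q+q'$, identities $0$ and inverses $-q$. Let $$\mathrm{HOM}_2(\mathcal A,\mathcal A')_1=\bigsqcup_{f,g}\mathrm{HOM}_2(\mathcal A,\mathcal A',f,g).$$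 For $q:(s,t)\Rightarrow(s',t')$ between homotopies $f\to g$ and $u=(u,v):g\to k$, the right whiskering $q\circledcirc u:(s\boxplus u,t\boxplus v)\Rightarrow(s'\boxplus u,t'\boxplus v)$ is the 2-fold homotopy given by the unique quadratic $(f,s\boxplus u,t\boxplus v)$-2-derivation which agrees with $q$ on $B$. **Theorem.** Right whiskering defines a right action, by groupoid maps, of the groupoid $\mathrm{HOM}(\mathcal A,\mathcal A')$ on the groupoid $\mathrm{HOM}_2(\mathcal A,\mathcal A')_1$, along the anchor map which sends a homotopy $f\to g$ to $g$. That is: the anchor map is constant on the arrows of $\mathrm{HOM}_2(\mathcal A,\mathcal A')_1$; for each arrow $u:g\to k$ of $\mathrm{HOM}(\mathcal A,\mathcal A')$ the assignment $h\mapsto h\boxplus u$ on objects and $q\mapsto q\circledcirc u$ on arrows is a functor from the part of $\mathrm{HOM}_2(\mathcal A,\mathcal A')_1$ over $g$ to the part over $k$; identity arrows act as identity functors; and $u\boxplus m$ acts as $u$ followed by $m$. In particular, for all composable data, $$(q+q')\circledcirc u=(q\circledcirc u)+(q'\circledcirc u),\qquad q\circledcirc(u\boxplus m)=(q\circledcirc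 u)\circledcirc m .$$ -/

import Mathlib

open CategoryTheory

universe u v₀ v₁ v₂ w₀ w₁ w₂ x

/-- A commutative associative algebra over `κ`, not required to have an identity element. -/
structure CAlg (κ : Type*) [CommRing κ] where
  carrier : Type*
  [ring : NonUnitalCommRing carrier]
  [module : Module κ carrier]
  [tower : IsScalarTower κ carrier carrier]
  [comm : SMulCommClass κ carrier carrier]

namespace CAlg

variable {κ : Type*} [CommRing κ]

instance : CoeSort (CAlg κ) (Type _) := ⟨CAlg.carrier⟩

instance (S : CAlg κ) : NonUnitalCommRing S := S.ring
instance (S : CAlg κ) : Module κ S := S.module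
instance (S : CAlg κ) : IsScalarTower κ S S := S.tower
instance (S : CAlg κ) : SMulCommClass κ S S := S.comm

end CAlg

/-- An action of the algebra `S` on the algebra `M`: a `κ`-bilinear map with
`s ▶ (m m') = (s ▶ m) m'` and `(s s') ▶ m = s ▶ (s' ▶ m)`.  (As `M` is commutative, the first law
also gives `s ▶ (m m') = m (s ▶ m')`.) -/
structure AlgAction {κ : Type*} [CommRing κ] (S M : CAlg κ) where
  toLin : S →ₗ[κ] M →ₗ[κ] M
  act_mul : ∀ s m m', toLin s (m * m') = toLin s m * m'
  mul_act : ∀ s s' m, toLin (s * s') m = toLin s (toLin s' m)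

namespace AlgAction

variable {κ : Type*} [CommRing κ] {S M : CAlg κ}

instance : CoeFun (AlgAction S M) (fun _ => S → M →ₗ[κ] M) := ⟨fun α => ⇑α.toLin⟩

lemma act_mul' (α : AlgAction S M) (s : S) (m m' : M) : α s (m * m') = m * α s m' := by
  rw [mul_comm, α.act_mul, mul_comm]

lemma act_comm (α : AlgAction S M) (s s' : S) (m : M) : α s (α s' m) = α s' (α s m) := by
  rw [← α.mul_act, mul_comm, α.mul_act]

end AlgAction

/-- The underlying set of the semidirect product `S ⋉ M`. -/
@[ext]
structure SemiCarrier {κ : Type*} [CommRing κ] {S M : CAlg κ} (α : AlgAction S M) where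
  fst : S
  snd : M

namespace SemiCarrier

variable {κ : Type*} [CommRing κ] {S M : CAlg κ} {α : AlgAction S M}

instance : Zero (SemiCarrier α) := ⟨⟨0, 0⟩⟩
instance : Add (SemiCarrier α) := ⟨fun x y => ⟨x.fst + y.fst, x.snd + y.snd⟩⟩
instance : Neg (SemiCarrier α) := ⟨fun x => ⟨-x.fst, -x.snd⟩⟩
instance : SMul κ (SemiCarrier α) := ⟨fun c x => ⟨c • x.fst, c • x.snd⟩⟩
/-- `(s, m) (s', m') = (s s', s ▶ m' + s' ▶ m + m m')`. -/
instance : Mul (SemiCarrier α) :=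
  ⟨fun x y => ⟨x.fst * y.fst, α x.fst y.snd + α y.fst x.snd + x.snd * y.snd⟩⟩

@[simp] lemma zero_fst : (0 : SemiCarrier α).fst = 0 := rfl
@[simp] lemma zero_snd : (0 : SemiCarrier α).snd = 0 := rfl
@[simp] lemma add_fst (x y : SemiCarrier α) : (x + y).fst = x.fst + y.fst := rfl
@[simp] lemma add_snd (x y : SemiCarrier α) : (x + y).snd = x.snd + y.snd := rfl
@[simp] lemma neg_fst (x : SemiCarrier α) : (-x).fst = -x.fst := rfl
@[simp] lemma neg_snd (x : SemiCarrier α) : (-x).snd = -x.snd := rfl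
@[simp] lemma smul_fst (c : κ) (x : SemiCarrier α) : (c • x).fst = c • x.fst := rfl
@[simp] lemma smul_snd (c : κ) (x : SemiCarrier α) : (c • x).snd = c • x.snd := rfl
@[simp] lemma mul_fst (x y : SemiCarrier α) : (x * y).fst = x.fst * y.fst := rfl
@[simp] lemma mul_snd (x y : SemiCarrier α) :
    (x * y).snd = α x.fst y.snd + α y.fst x.snd + x.snd * y.snd := rfl

instance : NonUnitalCommRing (SemiCarrier α) where
  add_assoc _ _ _ := by ext <;> simp [add_assoc]
  zero_add _ := by ext <;> simp
  add_zero _ := by ext <;> simp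
  add_comm _ _ := by ext <;> simp [add_comm]
  neg_add_cancel _ := by ext <;> simp
  nsmul := nsmulRec
  zsmul := zsmulRec
  left_distrib _ _ _ := by
    ext
    · simp [mul_add]
    · simp only [mul_snd, add_fst, add_snd, map_add, LinearMap.add_apply, mul_add]; abel
  right_distrib _ _ _ := by
    ext
    · simp [add_mul]
    · simp only [mul_snd, add_fst, add_snd, map_add, LinearMap.add_apply, add_mul]; abel
  zero_mul _ := by ext <;> simp
  mul_zero _ := by ext <;> simp
  mul_assoc x y z := by
    ext
    · simp [mul_assoc]
    · simp only [mul_snd, mul_fst, map_add, add_mul, mul_add, α.mul_act, α.act_mul, mul_assoc]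
      rw [α.act_comm z.fst x.fst, α.act_comm z.fst y.fst, ← α.act_mul' z.fst x.snd y.snd,
        ← α.act_mul' y.fst x.snd z.snd, α.act_mul, α.act_mul]
      abel
  mul_comm x y := by
    ext
    · simp [mul_comm]
    · simp only [mul_snd, mul_comm]; abel

instance : Module κ (SemiCarrier α) where
  one_smul _ := by ext <;> simp
  mul_smul _ _ _ := by ext <;> simp [mul_smul]
  smul_zero _ := by ext <;> simp
  smul_add _ _ _ := by ext <;> simp
  add_smul _ _ _ := by ext <;> simp [add_smul]
  zero_smul _ := by ext <;> simp

instance : IsScalarTower κ (SemiCarrier α) (SemiCarrier α) where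
  smul_assoc _ _ _ := by ext <;> simp [smul_mul_assoc]

instance : SMulCommClass κ (SemiCarrier α) (SemiCarrier α) where
  smul_comm _ _ _ := by ext <;> simp [mul_smul_comm]

end SemiCarrier

/-- The semidirect product `S ⋉ M`. -/
abbrev AlgAction.semi {κ : Type*} [CommRing κ] {S M : CAlg κ} (α : AlgAction S M) : CAlg κ where
  carrier := SemiCarrier α

set_option linter.checkUnivs false in
/-- A 2-crossed module `L → E → R` of commutative algebras. -/
structure TwoCrossedModule (κ : Type u) [CommRing κ] where
  R : CAlg.{u, v₀} κ
  E : CAlg.{u, v₁} κ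
  L : CAlg.{u, v₂} κ
  d₁ : E →ₙₐ[κ] R
  d₂ : L →ₙₐ[κ] E
  actE : AlgAction R E
  actL : AlgAction R L
  lift : E →ₗ[κ] E →ₗ[κ] L
  d₁_d₂ : ∀ l, d₁ (d₂ l) = 0
  d₁_act : ∀ r e, d₁ (actE r e) = r * d₁ e
  d₂_act : ∀ r l, d₂ (actL r l) = actE r (d₂ l)
  d₂_lift : ∀ e e', d₂ (lift e e') = e * e' - actE (d₁ e') e
  lift_d₂_d₂ : ∀ l l', lift (d₂ l) (d₂ l') = l * l'
  lift_mul : ∀ e e' e'', lift e (e' * e'') = lift (e * e') e'' + actL (d₁ e'') (lift e e')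
  /-- `{∂₂ l ⊗ e} = e ▶' l - ∂₁ e ▶ l`, where `e ▶' l = {e ⊗ ∂₂ l}`. -/
  lift_d₂ : ∀ l e, lift (d₂ l) e = lift e (d₂ l) - actL (d₁ e) l
  act_lift_left : ∀ r e e', actL r (lift e e') = lift (actE r e) e'
  act_lift_right : ∀ r e e', actL r (lift e e') = lift e (actE r e')

namespace TwoCrossedModule

variable {κ : Type u} [CommRing κ]

/-- The action `e ▶' l = {e ⊗ ∂₂ l}` of `E` on `L`. -/
def actEL (A : TwoCrossedModule κ) : AlgAction A.E A.L where
  toLin := A.lift.compl₂ (A.d₂ : A.L →ₗ[κ] A.E)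
  act_mul e l l' := by
    change A.lift e (A.d₂ (l * l')) = A.lift e (A.d₂ l) * l'
    rw [map_mul, A.lift_mul, A.d₁_d₂, ← A.lift_d₂_d₂, A.d₂_lift, A.d₁_d₂]
    simp
  mul_act e e' l := by
    change A.lift (e * e') (A.d₂ l) = A.lift e (A.d₂ (A.lift e' (A.d₂ l)))
    rw [A.d₂_lift, A.d₁_d₂, map_zero, LinearMap.zero_apply, sub_zero, A.lift_mul, A.d₁_d₂]
    simp

lemma actEL_apply (A : TwoCrossedModule κ) (e : A.E) (l : A.L) :
    A.actEL e l = A.lift e (A.d₂ l) := rfl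

lemma lift_d₂_right (A : TwoCrossedModule κ) (e : A.E) (l : A.L) :
    A.lift e (A.d₂ l) = A.actEL e l := rfl

lemma lift_d₂_left (A : TwoCrossedModule κ) (e : A.E) (l : A.L) :
    A.lift (A.d₂ l) e = A.actEL e l - A.actL (A.d₁ e) l := A.lift_d₂ l e

lemma actEL_d₂ (A : TwoCrossedModule κ) (l l' : A.L) : A.actEL (A.d₂ l) l' = l * l' :=
  A.lift_d₂_d₂ l l'

lemma d₂_actEL (A : TwoCrossedModule κ) (e : A.E) (l : A.L) :
    A.d₂ (A.actEL e l) = e * A.d₂ l := by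
  rw [actEL_apply, d₂_lift, d₁_d₂]; simp

lemma actEL_actE (A : TwoCrossedModule κ) (r : A.R) (e : A.E) (l : A.L) :
    A.actEL (A.actE r e) l = A.actL r (A.actEL e l) := by
  rw [actEL_apply, actEL_apply, act_lift_left]

lemma actEL_actL (A : TwoCrossedModule κ) (r : A.R) (e : A.E) (l : A.L) :
    A.actEL e (A.actL r l) = A.actL r (A.actEL e l) := by
  rw [actEL_apply, actEL_apply, act_lift_right, d₂_act]

/-- The algebra of 1-simplices `R ⋉ E`. -/
abbrev simp₁ (A : TwoCrossedModule κ) : CAlg κ := A.actE.semi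

/-- The action `(r, e) ▶ (e', l) = (e e' + r ▶ e', ∂₁ e ▶ l + r ▶ l - {e' ⊗ e})` of `R ⋉ E` on
`E ⋉ L`. -/
def bullet (A : TwoCrossedModule.{u, v₀, v₁, v₂} κ) : AlgAction A.simp₁ A.actEL.semi where
  toLin := LinearMap.mk₂ κ
    (fun (x : SemiCarrier A.actE) (y : SemiCarrier A.actEL) =>
      (⟨x.snd * y.fst + A.actE x.fst y.fst,
        A.actL (A.d₁ x.snd) y.snd + A.actL x.fst y.snd - A.lift y.fst x.snd⟩ :
        SemiCarrier A.actEL))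
    (fun _ _ _ => by
      apply SemiCarrier.ext
      · simp [add_mul]; abel
      · simp; abel)
    (fun _ _ _ => by
      apply SemiCarrier.ext
      · simp [smul_mul_assoc]
      · simp [smul_sub])
    (fun _ _ _ => by
      apply SemiCarrier.ext
      · simp [mul_add]; abel
      · simp; abel)
    (fun _ _ _ => by
      apply SemiCarrier.ext
      · simp [mul_smul_comm]
      · simp [smul_sub])
  act_mul x y z := by
    have key : ∀ (e e₁ : A.E) (l : A.L), A.lift e₁ e * l
        = A.actEL (e₁ * e) l - A.actL (A.d₁ e) (A.actEL e₁ l) := by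
      intro e e₁ l
      rw [← A.actEL_d₂, A.d₂_lift, map_sub, LinearMap.sub_apply, A.actEL_actE]
    have key2 : ∀ (e e₁ e₂ : A.E), A.actEL e₂ (A.lift e₁ e) = A.lift (e₁ * e₂) e := by
      intro e e₁ e₂
      rw [actEL_apply, d₂_lift, map_sub, A.lift_mul, ← A.act_lift_right, mul_comm e₁]
      abel
    obtain ⟨r, e⟩ := x
    obtain ⟨e₁, l₁⟩ := y
    obtain ⟨e₂, l₂⟩ := z
    refine SemiCarrier.ext ?_ ?_
    · change e * (e₁ * e₂) + A.actE r (e₁ * e₂) = (e * e₁ + A.actE r e₁) * e₂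
      rw [A.actE.act_mul, add_mul, mul_assoc]
    · change A.actL (A.d₁ e) (A.actEL e₁ l₂ + A.actEL e₂ l₁ + l₁ * l₂)
          + A.actL r (A.actEL e₁ l₂ + A.actEL e₂ l₁ + l₁ * l₂) - A.lift (e₁ * e₂) e
        = A.actEL (e * e₁ + A.actE r e₁) l₂
          + A.actEL e₂ (A.actL (A.d₁ e) l₁ + A.actL r l₁ - A.lift e₁ e)
          + (A.actL (A.d₁ e) l₁ + A.actL r l₁ - A.lift e₁ e) * l₂
      simp only [map_add, map_sub, LinearMap.add_apply, add_mul, sub_mul, key, key2, A.actEL_actE,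
        A.actEL_actL, A.actL.act_mul, mul_comm e₁ e]
      abel
  mul_act x y z := by
    obtain ⟨r, e⟩ := x
    obtain ⟨r', e'⟩ := y
    obtain ⟨e₁, l₁⟩ := z
    refine SemiCarrier.ext ?_ ?_
    · change (A.actE r e' + A.actE r' e + e * e') * e₁ + A.actE (r * r') e₁
        = e * (e' * e₁ + A.actE r' e₁) + A.actE r (e' * e₁ + A.actE r' e₁)
      simp only [map_add, add_mul, mul_add, A.actE.act_mul, A.actE.mul_act, mul_assoc]
      rw [← A.actE.act_mul' r' e e₁, A.actE.act_mul r' e e₁]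
      abel
    · change A.actL (A.d₁ (A.actE r e' + A.actE r' e + e * e')) l₁ + A.actL (r * r') l₁
          - A.lift e₁ (A.actE r e' + A.actE r' e + e * e')
        = A.actL (A.d₁ e) (A.actL (A.d₁ e') l₁ + A.actL r' l₁ - A.lift e₁ e')
          + A.actL r (A.actL (A.d₁ e') l₁ + A.actL r' l₁ - A.lift e₁ e')
          - A.lift (e' * e₁ + A.actE r' e₁) e
      have h : A.lift e₁ (e * e') = A.lift (e' * e₁) e + A.actL (A.d₁ e) (A.lift e₁ e') := by
        rw [mul_comm e, A.lift_mul, mul_comm e']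
      simp only [map_add, map_sub, map_mul, LinearMap.add_apply, A.d₁_act, A.actL.mul_act, h,
        ← A.act_lift_left, ← A.act_lift_right]
      rw [A.actL.act_comm r' (A.d₁ e)]
      abel

lemma bullet_apply (A : TwoCrossedModule κ) (r : A.R) (e e' : A.E) (l : A.L) :
    A.bullet (⟨r, e⟩ : SemiCarrier A.actE) (⟨e', l⟩ : SemiCarrier A.actEL)
      = (⟨e * e' + A.actE r e', A.actL (A.d₁ e) l + A.actL r l - A.lift e' e⟩ :
        SemiCarrier A.actEL) := rfl

/-- The algebra of 2-simplices `(R ⋉ E) ⋉ (E ⋉ L)`. -/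
abbrev simp₂ (A : TwoCrossedModule κ) : CAlg κ := A.bullet.semi

/-- The 2-simplex `(r, e, e', l)`. -/
abbrev triangle (A : TwoCrossedModule κ) (r : A.R) (e e' : A.E) (l : A.L) : A.simp₂ :=
  (⟨(⟨r, e⟩ : SemiCarrier A.actE), (⟨e', l⟩ : SemiCarrier A.actEL)⟩ : SemiCarrier A.bullet)

/-- A 2-crossed module map `f = (f₂, f₁, f₀)`. -/
@[ext]
structure Map (A : TwoCrossedModule.{u, v₀, v₁, v₂} κ)
    (A' : TwoCrossedModule.{u, w₀, w₁, w₂} κ) where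
  f₀ : A.R →ₙₐ[κ] A'.R
  f₁ : A.E →ₙₐ[κ] A'.E
  f₂ : A.L →ₙₐ[κ] A'.L
  f₀_d₁ : ∀ e, f₀ (A.d₁ e) = A'.d₁ (f₁ e)
  f₁_d₂ : ∀ l, f₁ (A.d₂ l) = A'.d₂ (f₂ l)
  f₁_act : ∀ r e, f₁ (A.actE r e) = A'.actE (f₀ r) (f₁ e)
  f₂_act : ∀ r l, f₂ (A.actL r l) = A'.actL (f₀ r) (f₂ l)
  f₂_lift : ∀ e e', f₂ (A.lift e e') = A'.lift (f₁ e) (f₁ e')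

/-- `u` is an identity element of the algebra `S`.  (Algebras need not have one.) -/
def IsIdentity (S : CAlg.{u, x} κ) (u : S) : Prop := ∀ r : S, u * r = r

/-- A (chosen) basis of `R` as a free algebra, indexed by `B`: an identification of `R` with the
polynomial algebra `κ[B]`, or with its ideal of polynomials without constant term (the free
algebra on `B` when algebras are not required to have an identity element). -/
structure Basis (R : CAlg.{u, v₀} κ) (B : Type x) where
  elt : B → R
  isFree : ∃ φ : R →ₙₐ[κ] MvPolynomial B κ, Function.Injective φ ∧
    (∀ i, φ (elt i) = MvPolynomial.X i) ∧
    (Set.range φ = Set.univ ∨ Set.range φ = {p | MvPolynomial.constantCoeff p = 0})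

/-- Induction on the elements of a free algebra. -/
lemma Basis.induction {R : CAlg.{u, v₀} κ} {B : Type x} (b : Basis R B) {p : R → Prop}
    (h_basis : ∀ i, p (b.elt i)) (h_one : ∀ u, IsIdentity R u → p u)
    (h_add : ∀ r r', p r → p r' → p (r + r')) (h_smul : ∀ (c : κ) r, p r → p (c • r))
    (h_mul : ∀ r r', p r → p r' → p (r * r')) (r : R) : p r := by
  obtain ⟨φ, hinj, hX, hran⟩ := b.isFree
  by_cases hB : Nonempty B
  swap
  · -- no variables
    have hφ : ∀ q : MvPolynomial B κ, ∃ c : κ, q = MvPolynomial.C c := by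
      have := not_nonempty_iff.mp hB
      intro q
      exact ⟨_, MvPolynomial.eq_C_of_isEmpty q⟩
    rcases hran with hran | hran
    · obtain ⟨u, hu⟩ : (1 : MvPolynomial B κ) ∈ Set.range φ := by rw [hran]; trivial
      have h1 : IsIdentity R u := fun r => hinj (by rw [map_mul, hu, one_mul])
      obtain ⟨c, hc⟩ := hφ (φ r)
      have : r = c • u := hinj (by
        rw [hc, map_smul, hu, MvPolynomial.smul_eq_C_mul, mul_one])
      rw [this]
      exact h_smul _ _ (h_one u h1)
    · have h0 : r = 0 := by
        apply hinj
        obtain ⟨c, hc⟩ := hφ (φ r)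
        have : φ r ∈ Set.range φ := ⟨r, rfl⟩
        rw [hran, hc] at this
        simp only [Set.mem_ofPred_eq, MvPolynomial.constantCoeff_C] at this
        rw [hc, this, map_zero, map_zero]
      have : IsIdentity R r := fun r' => by
        apply hinj
        obtain ⟨c, hc⟩ := hφ (φ r')
        have h2 : φ r' ∈ Set.range φ := ⟨r', rfl⟩
        rw [hran, hc] at h2
        simp only [Set.mem_ofPred_eq, MvPolynomial.constantCoeff_C] at h2
        rw [hc, h2, h0]; simp
      exact h_one r this
  obtain ⟨i₀⟩ := hB
  have h_zero : p 0 := by simpa using h_smul 0 _ (h_basis i₀)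
  have key : ∀ q : MvPolynomial B κ, ∃ (c : κ) (t : R), p t ∧ q = MvPolynomial.C c + φ t := by
    intro q
    induction q using MvPolynomial.induction_on with
    | C a => exact ⟨a, 0, h_zero, by simp⟩
    | add q q' hq hq' =>
      obtain ⟨c, t, ht, rfl⟩ := hq
      obtain ⟨c', t', ht', rfl⟩ := hq'
      exact ⟨c + c', t + t', h_add _ _ ht ht', by simp only [map_add]; abel⟩
    | mul_X q i hq =>
      obtain ⟨c, t, ht, rfl⟩ := hq
      refine ⟨0, c • b.elt i + t * b.elt i,
        h_add _ _ (h_smul _ _ (h_basis i)) (h_mul _ _ ht (h_basis i)), ?_⟩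
      rw [map_add, map_smul, map_mul, hX, MvPolynomial.smul_eq_C_mul]
      simp [add_mul]
  obtain ⟨c, t, ht, hq⟩ := key (φ r)
  rcases hran with hran | hran
  · obtain ⟨u, hu⟩ : (1 : MvPolynomial B κ) ∈ Set.range φ := by rw [hran]; trivial
    have h1 : IsIdentity R u := fun r => hinj (by rw [map_mul, hu, one_mul])
    have : r = c • u + t := hinj (by
      rw [hq, map_add, map_smul, hu, MvPolynomial.smul_eq_C_mul, mul_one])
    rw [this]
    exact h_add _ _ (h_smul _ _ (h_one u h1)) ht
  · have hr : φ r ∈ Set.range φ := ⟨r, rfl⟩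
    have ht' : φ t ∈ Set.range φ := ⟨t, rfl⟩
    rw [hran] at hr ht'
    simp only [Set.mem_ofPred_eq] at hr ht'
    have hc : c = 0 := by
      have := congrArg MvPolynomial.constantCoeff hq
      rw [hr, map_add, ht', MvPolynomial.constantCoeff_C, add_zero] at this
      exact this.symm
    have : r = t := hinj (by rw [hq, hc, map_zero, zero_add])
    rw [this]; exact ht

/-- The universal property of a free algebra: a family `φ` of elements of `S` extends to an
algebra map, with a prescribed value `h u` at the identity elements `u` (if any). -/
lemma Basis.exists_extend {R : CAlg.{u, v₀} κ} {B : Type x} (b : Basis R B) {S : CAlg.{u, w₀} κ}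
    (h : R →ₙₐ[κ] S) (φ : B → S) (hφ : ∀ u, IsIdentity R u → ∀ i, h u * φ i = φ i) :
    ∃ F : R →ₙₐ[κ] S, (∀ i, F (b.elt i) = φ i) ∧ ∀ u, IsIdentity R u → F u = h u := by
  obtain ⟨ψ, hinj, hX, hran⟩ := b.isFree
  let G : MvPolynomial B κ →ₐ[κ] Unitization κ S :=
    MvPolynomial.aeval (fun i => (Unitization.inr (φ i) : Unitization κ S))
  have hGX : ∀ i, G (MvPolynomial.X i) = Unitization.inr (φ i) := fun i => by
    simp [G]
  have hfst : ∀ q, (G q).fst = MvPolynomial.constantCoeff q := by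
    intro q
    induction q using MvPolynomial.induction_on with
    | C a => simp [G, Unitization.algebraMap_eq_inl]
    | add q q' hq hq' => simp [hq, hq']
    | mul_X q i hq => simp [hGX]
  have hone : ∀ u, IsIdentity R u → ∀ q, h u * (G q).snd = (G q).snd := by
    intro u hu q
    induction q using MvPolynomial.induction_on with
    | C a => simp [G, Unitization.algebraMap_eq_inl]
    | add q q' hq hq' => simp [mul_add, hq, hq']
    | mul_X q i hq =>
      rw [map_mul, hGX, Unitization.snd_mul]
      simp [mul_add, ← mul_assoc, hq, mul_smul_comm, hφ u hu i]
  rcases hran with hran | hran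
  · obtain ⟨u, hu⟩ : (1 : MvPolynomial B κ) ∈ Set.range ψ := by rw [hran]; trivial
    have h1 : IsIdentity R u := fun r => hinj (by rw [map_mul, hu, one_mul])
    refine ⟨{ toFun := fun r => (G (ψ r)).snd + (MvPolynomial.constantCoeff (ψ r)) • h u
              map_smul' := ?_, map_zero' := ?_, map_add' := ?_, map_mul' := ?_ }, ?_, ?_⟩
    · intro c r
      simp [mul_smul, MvPolynomial.constantCoeff_smul]
    · simp
    · intro r r'
      simp only [map_add, Unitization.snd_add, add_smul]; abel
    · intro r r'
      have e1 := hone u h1 (ψ r)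
      have e2 := hone u h1 (ψ r')
      have e3 : h u * h u = h u := by rw [← map_mul, h1]
      simp only [map_mul, Unitization.snd_mul, hfst, mul_add, add_mul, mul_smul_comm,
        smul_mul_assoc, e2, e3, mul_comm (G (ψ r)).snd (h u), e1, mul_smul, smul_add]
      rw [smul_comm (MvPolynomial.constantCoeff (ψ r)) (MvPolynomial.constantCoeff (ψ r'))]
      abel
    · intro i
      simp [hX, hGX]
    · intro u' hu'
      have : u' = u := by rw [← h1 u', mul_comm, hu']
      subst this
      simp [hu]
  · refine ⟨{ toFun := fun r => (G (ψ r)).snd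
              map_smul' := ?_, map_zero' := ?_, map_add' := ?_, map_mul' := ?_ }, ?_, ?_⟩
    · intro c r
      simp
    · simp
    · intro r r'
      simp
    · intro r r'
      have hc : ∀ r, MvPolynomial.constantCoeff (ψ r) = 0 := fun r => by
        have : ψ r ∈ Set.range ψ := ⟨r, rfl⟩
        rw [hran] at this
        exact this
      simp [hfst, hc]
    · intro i
      simp [hX, hGX]
    · intro u hu
      classical
      have h0 : u = 0 := by
        apply hinj
        rw [map_zero]
        have hcu : MvPolynomial.constantCoeff (ψ u) = 0 := by
          have : ψ u ∈ Set.range ψ := ⟨u, rfl⟩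
          rw [hran] at this
          exact this
        by_cases hB : Nonempty B
        · obtain ⟨i⟩ := hB
          have h2 : ψ u * MvPolynomial.X i = MvPolynomial.X i := by
            rw [← hX i, ← map_mul, hu]
          have h3 := congrArg (MvPolynomial.coeff (Finsupp.single i 1)) h2
          rw [MvPolynomial.coeff_X, show (Finsupp.single i 1 : B →₀ ℕ) = 0 + Finsupp.single i 1 by
            simp, MvPolynomial.coeff_mul_X, ← MvPolynomial.constantCoeff_eq, hcu, if_pos rfl] at h3
          have : Subsingleton κ := subsingleton_of_zero_eq_one h3
          exact Subsingleton.elim _ _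
        · have := not_nonempty_iff.mp hB
          rw [MvPolynomial.eq_C_of_isEmpty (ψ u), ← MvPolynomial.constantCoeff_eq, hcu, map_zero]
      subst h0
      simp

section Homotopies

variable {A : TwoCrossedModule.{u, v₀, v₁, v₂} κ} {A' : TwoCrossedModule.{u, w₀, w₁, w₂} κ}

/-- `s : R → E'` is an `f₀`-derivation: a linear map such that `r ↦ (f₀ r, s r)` is an algebra map
`R → R' ⋉ E'`.  If `R` has an identity element `1`, this algebra map is required to send it to
`(f₀ 1, 0)`. -/
structure IsDerivation (f₀ : A.R →ₙₐ[κ] A'.R) (s : A.R →ₗ[κ] A'.E) : Prop where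
  map_mul : ∀ r r', s (r * r') = A'.actE (f₀ r) (s r') + A'.actE (f₀ r') (s r) + s r * s r'
  map_identity : ∀ u, IsIdentity A.R u → s u = 0

/-- `(s, t)` is a quadratic `f`-derivation. -/
structure IsQuadraticDerivation (f : Map A A') (s : A.R →ₗ[κ] A'.E) (t : A.E →ₗ[κ] A'.L) :
    Prop where
  isDerivation : IsDerivation f.f₀ s
  map_mul : ∀ e e', t (e * e') = A'.lift (s (A.d₁ e)) (f.f₁ e') + A'.lift (s (A.d₁ e')) (f.f₁ e)
    + A'.actEL (f.f₁ e) (t e') + A'.actEL (f.f₁ e') (t e)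
    + A'.actEL (s (A.d₁ e)) (t e') + A'.actEL (s (A.d₁ e')) (t e) + t e * t e'
  map_act : ∀ r e, t (A.actE r e) = A'.actL (f.f₀ r) (t e) + A'.actL (A'.d₁ (s r)) (t e)
    + A'.lift (s r) (f.f₁ e) - A'.lift (f.f₁ e) (s r) - A'.lift (s (A.d₁ e)) (s r)

/-- A homotopy `f → g`: a quadratic `f`-derivation `(s, t)` connecting `f` to `g`. -/
@[ext]
structure Homotopy (f g : Map A A') where
  s : A.R →ₗ[κ] A'.E
  t : A.E →ₗ[κ] A'.L
  isQuadraticDerivation : IsQuadraticDerivation f s t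
  target₀ : ∀ r, g.f₀ r = f.f₀ r + A'.d₁ (s r)
  target₁ : ∀ e, g.f₁ e = f.f₁ e + s (A.d₁ e) + A'.d₂ (t e)
  target₂ : ∀ l, g.f₂ l = f.f₂ l + t (A.d₂ l)

variable {B : Type x} {f g k : Map A A'}

lemma Homotopy.isDerivation (h : Homotopy f g) : IsDerivation f.f₀ h.s :=
  h.isQuadraticDerivation.isDerivation

/-- An `f₀`-derivation is determined by its values on a basis. -/
lemma IsDerivation.eq_of_basis (b : Basis A.R B) {f₀ : A.R →ₙₐ[κ] A'.R}
    {s s' : A.R →ₗ[κ] A'.E} (hs : IsDerivation f₀ s) (hs' : IsDerivation f₀ s')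
    (h : ∀ i, s (b.elt i) = s' (b.elt i)) : s = s' := by
  refine LinearMap.ext fun r => ?_
  induction r using b.induction with
  | h_basis i => exact h i
  | h_one u hu => rw [hs.map_identity u hu, hs'.map_identity u hu]
  | h_add r r' hr hr' => rw [map_add, map_add, hr, hr']
  | h_smul c r hr => rw [map_smul, map_smul, hr]
  | h_mul r r' hr hr' => rw [hs.map_mul, hs'.map_mul, hr, hr']

/-- Values on a basis extend uniquely to an `f₀`-derivation. -/
lemma existsUnique_derivation (b : Basis A.R B) (f₀ : A.R →ₙₐ[κ] A'.R) (φ : B → A'.E)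
    (hφ : ∀ u, IsIdentity A.R u → ∀ i, A'.actE (f₀ u) (φ i) = φ i) :
    ∃! s : A.R →ₗ[κ] A'.E, IsDerivation f₀ s ∧ ∀ i, s (b.elt i) = φ i := by
  refine existsUnique_of_exists_of_unique ?_
    fun s s' h h' => h.1.eq_of_basis b h'.1 fun i => by rw [h.2, h'.2]
  let h : A.R →ₙₐ[κ] A'.simp₁ :=
    { toFun := fun r => (⟨f₀ r, 0⟩ : SemiCarrier A'.actE)
      map_smul' := fun c r => by apply SemiCarrier.ext <;> simp
      map_zero' := by apply SemiCarrier.ext <;> simp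
      map_add' := fun r r' => by apply SemiCarrier.ext <;> simp
      map_mul' := fun r r' => by apply SemiCarrier.ext <;> simp }
  obtain ⟨F, hF, hF'⟩ := b.exists_extend h
    (fun i => (⟨f₀ (b.elt i), φ i⟩ : SemiCarrier A'.actE)) (by
      intro u hu i
      apply SemiCarrier.ext
      · change f₀ u * f₀ (b.elt i) = f₀ (b.elt i)
        rw [← map_mul, hu]
      · change A'.actE (f₀ u) (φ i) + A'.actE (f₀ (b.elt i)) 0 + 0 * φ i = φ i
        simp [hφ u hu i])
  have hfst : ∀ r, (F r).fst = f₀ r := by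
    intro r
    induction r using b.induction with
    | h_basis i => rw [hF]
    | h_one u hu => rw [hF' u hu]; rfl
    | h_add r r' hr hr' => rw [map_add, map_add, ← hr, ← hr']; rfl
    | h_smul c r hr => rw [map_smul, map_smul, ← hr]; rfl
    | h_mul r r' hr hr' => rw [map_mul, map_mul, ← hr, ← hr']; rfl
  refine ⟨{ toFun := fun r => (F r).snd, map_add' := ?_, map_smul' := ?_ }, ⟨?_, ?_⟩, ?_⟩
  · intro r r'
    rw [map_add]; rfl
  · intro c r
    rw [map_smul]; rfl
  · intro r r'
    change (F (r * r')).snd = A'.actE (f₀ r) (F r').snd + A'.actE (f₀ r') (F r).snd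
      + (F r).snd * (F r').snd
    rw [map_mul, ← hfst, ← hfst]; rfl
  · intro u hu
    change (F u).snd = 0
    rw [hF' u hu]; rfl
  · intro i
    change (F (b.elt i)).snd = φ i
    rw [hF]

lemma IsDerivation.act_identity {f₀ : A.R →ₙₐ[κ] A'.R} {s : A.R →ₗ[κ] A'.E}
    (hs : IsDerivation f₀ s) (u : A.R) (hu : IsIdentity A.R u) (r : A.R) :
    A'.actE (f₀ u) (s r) = s r := by
  have h := hs.map_mul u r
  rw [hu, hs.map_identity u hu] at h
  simpa using h.symm

lemma Homotopy.target_identity (h : Homotopy f g) (u : A.R) (hu : IsIdentity A.R u) :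
    g.f₀ u = f.f₀ u := by
  rw [h.target₀, h.isDerivation.map_identity u hu]; simp

/-- For homotopies `(s, t) : f → g` and `(s', t') : g → k` there is a unique `f₀`-derivation which
agrees with `s + s'` on the basis. -/
lemma existsUnique_concatS (b : Basis A.R B) (h : Homotopy f g) (h' : Homotopy g k) :
    ∃! s : A.R →ₗ[κ] A'.E, IsDerivation f.f₀ s ∧
      ∀ i, s (b.elt i) = h.s (b.elt i) + h'.s (b.elt i) := by
  refine existsUnique_derivation b f.f₀ (fun i => h.s (b.elt i) + h'.s (b.elt i)) ?_
  intro u hu i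
  rw [map_add, h.isDerivation.act_identity u hu, ← h.target_identity u hu,
    h'.isDerivation.act_identity u hu]

/-- The derivation `s ⊞ s'`: the unique `f₀`-derivation which agrees with `s + s'` on the basis. -/
noncomputable def concatS (b : Basis A.R B) (h : Homotopy f g) (h' : Homotopy g k) :
    A.R →ₗ[κ] A'.E := (existsUnique_concatS b h h').choose

lemma concatS_isDerivation (b : Basis A.R B) (h : Homotopy f g) (h' : Homotopy g k) :
    IsDerivation f.f₀ (concatS b h h') := (existsUnique_concatS b h h').choose_spec.1.1

lemma concatS_elt (b : Basis A.R B) (h : Homotopy f g) (h' : Homotopy g k) (i : B) :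
    concatS b h h' (b.elt i) = h.s (b.elt i) + h'.s (b.elt i) :=
  (existsUnique_concatS b h h').choose_spec.1.2 i

/-- `w : R → L'` is the map `w^(s,s')`: it is linear, `r ↦ (f₀ r, s r, s' r - ∂₂ (w r), w r)` (the
2-simplex with vertices `f₀ r, g₀ r, k₀ r`, with edges `s r`, `s' r`, `s r + s' r - ∂₂ (w r)`, and
with interior `w r`) is an algebra map into the algebra of 2-simplices of `A'`, and `w` vanishes on
the basis (and at the identity element of `R`, if there is one). -/
structure IsW (b : Basis A.R B) (f₀ : A.R →ₙₐ[κ] A'.R) (s s' : A.R →ₗ[κ] A'.E)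
    (w : A.R →ₗ[κ] A'.L) : Prop where
  exists_hom : ∃ X : A.R →ₙₐ[κ] A'.simp₂,
    ∀ r, X r = A'.triangle (f₀ r) (s r) (s' r - A'.d₂ (w r)) (w r)
  elt : ∀ i, w (b.elt i) = 0
  map_identity : ∀ u, IsIdentity A.R u → w u = 0

lemma IsW.map_mul {b : Basis A.R B} {f₀ : A.R →ₙₐ[κ] A'.R} {s s' : A.R →ₗ[κ] A'.E}
    {w : A.R →ₗ[κ] A'.L} (hw : IsW b f₀ s s' w) (r r' : A.R) :
    w (r * r') = A'.actL (f₀ r) (w r') + A'.actL (f₀ r') (w r)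
      + A'.actEL (s r + s' r) (w r') + A'.actEL (s r' + s' r') (w r)
      - A'.lift (s' r') (s r) - A'.lift (s' r) (s r') - w r * w r' := by
  obtain ⟨X, hX⟩ := hw.exists_hom
  have h := congrArg (fun z : SemiCarrier A'.bullet => (SemiCarrier.snd z).snd)
    (_root_.map_mul X r r')
  rw [hX, hX, hX] at h
  change w (r * r') = A'.actL (A'.d₁ (s r)) (w r') + A'.actL (f₀ r) (w r')
    - A'.lift (s' r' - A'.d₂ (w r')) (s r) + (A'.actL (A'.d₁ (s r')) (w r) + A'.actL (f₀ r') (w r)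
    - A'.lift (s' r - A'.d₂ (w r)) (s r')) + (A'.actEL (s' r - A'.d₂ (w r)) (w r')
      + A'.actEL (s' r' - A'.d₂ (w r')) (w r) + w r * w r') at h
  rw [h]
  simp only [map_sub, map_add, LinearMap.sub_apply, LinearMap.add_apply, A'.lift_d₂_left,
    A'.actEL_d₂, mul_comm (w r') (w r)]
  abel

lemma IsW.unique {b : Basis A.R B} {f₀ : A.R →ₙₐ[κ] A'.R} {s s' : A.R →ₗ[κ] A'.E}
    {w w' : A.R →ₗ[κ] A'.L} (hw : IsW b f₀ s s' w) (hw' : IsW b f₀ s s' w') : w = w' := by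
  refine LinearMap.ext fun r => ?_
  induction r using b.induction with
  | h_basis i => rw [hw.elt, hw'.elt]
  | h_one u hu => rw [hw.map_identity u hu, hw'.map_identity u hu]
  | h_add r r' hr hr' => rw [map_add, map_add, hr, hr']
  | h_smul c r hr => rw [map_smul, map_smul, hr]
  | h_mul r r' hr hr' => rw [hw.map_mul, hw'.map_mul, hr, hr']

lemma existsUnique_w (b : Basis A.R B) (h : Homotopy f g) {s' : A.R →ₗ[κ] A'.E}
    (hs' : IsDerivation g.f₀ s') : ∃! w : A.R →ₗ[κ] A'.L, IsW b f.f₀ h.s s' w := by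
  refine existsUnique_of_exists_of_unique ?_ fun w w' hw hw' => hw.unique hw'
  let H : A.R →ₙₐ[κ] A'.simp₂ :=
    { toFun := fun r => A'.triangle (f.f₀ r) 0 0 0
      map_smul' := fun c r => by
        apply SemiCarrier.ext <;> apply SemiCarrier.ext <;> simp
      map_zero' := by apply SemiCarrier.ext <;> apply SemiCarrier.ext <;> simp
      map_add' := fun r r' => by apply SemiCarrier.ext <;> apply SemiCarrier.ext <;> simp
      map_mul' := fun r r' => by
        apply SemiCarrier.ext <;> apply SemiCarrier.ext
        · exact _root_.map_mul f.f₀ r r'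
        · change (0 : A'.E) = A'.actE (f.f₀ r) 0 + A'.actE (f.f₀ r') 0 + 0 * 0
          simp
        · change (0 : A'.E) = (0 * 0 + A'.actE (f.f₀ r) 0) + (0 * 0 + A'.actE (f.f₀ r') 0) + 0 * 0
          simp
        · change (0 : A'.L) = (A'.actL (A'.d₁ 0) 0 + A'.actL (f.f₀ r) 0 - A'.lift 0 0)
            + (A'.actL (A'.d₁ 0) 0 + A'.actL (f.f₀ r') 0 - A'.lift 0 0)
            + (A'.actEL 0 0 + A'.actEL 0 0 + 0 * 0)
          simp }
  obtain ⟨F, hF, hF'⟩ := b.exists_extend H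
    (fun i => A'.triangle (f.f₀ (b.elt i)) (h.s (b.elt i)) (s' (b.elt i)) 0) (by
      intro u hu i
      apply SemiCarrier.ext <;> apply SemiCarrier.ext
      · change f.f₀ u * f.f₀ (b.elt i) = f.f₀ (b.elt i)
        rw [← map_mul, hu]
      · change A'.actE (f.f₀ u) (h.s (b.elt i)) + A'.actE (f.f₀ (b.elt i)) 0
          + 0 * h.s (b.elt i) = h.s (b.elt i)
        simp [h.isDerivation.act_identity u hu]
      · change (0 * s' (b.elt i) + A'.actE (f.f₀ u) (s' (b.elt i)))
          + (h.s (b.elt i) * 0 + A'.actE (f.f₀ (b.elt i)) 0) + 0 * s' (b.elt i)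
          = s' (b.elt i)
        simp [← h.target_identity u hu, hs'.act_identity u hu]
      · change (A'.actL (A'.d₁ 0) 0 + A'.actL (f.f₀ u) 0 - A'.lift (s' (b.elt i)) 0)
          + (A'.actL (A'.d₁ (h.s (b.elt i))) 0 + A'.actL (f.f₀ (b.elt i)) 0
            - A'.lift 0 (h.s (b.elt i)))
          + (A'.actEL 0 0 + A'.actEL (s' (b.elt i)) 0 + 0 * 0) = 0
        simp)
  have h1 : ∀ r, (SemiCarrier.fst (F r : SemiCarrier A'.bullet)).fst = f.f₀ r := by
    intro r
    induction r using b.induction with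
    | h_basis i => rw [hF]
    | h_one u hu => rw [hF' u hu]; rfl
    | h_add r r' hr hr' => rw [map_add, map_add, ← hr, ← hr']; rfl
    | h_smul c r hr => rw [map_smul, map_smul, ← hr]; rfl
    | h_mul r r' hr hr' => rw [map_mul, map_mul, ← hr, ← hr']; rfl
  have h2 : ∀ r, (SemiCarrier.fst (F r : SemiCarrier A'.bullet)).snd = h.s r := by
    intro r
    induction r using b.induction with
    | h_basis i => rw [hF]
    | h_one u hu => rw [hF' u hu, h.isDerivation.map_identity u hu]; rfl
    | h_add r r' hr hr' => rw [map_add, map_add, ← hr, ← hr']; rfl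
    | h_smul c r hr => rw [map_smul, map_smul, ← hr]; rfl
    | h_mul r r' hr hr' =>
      rw [map_mul, h.isDerivation.map_mul, ← hr, ← hr', ← h1, ← h1]; rfl
  have h3 : ∀ r, (SemiCarrier.snd (F r : SemiCarrier A'.bullet)).fst
      + A'.d₂ (SemiCarrier.snd (F r : SemiCarrier A'.bullet)).snd = s' r := by
    intro r
    induction r using b.induction with
    | h_basis i => rw [hF]; simp
    | h_one u hu =>
      rw [hF' u hu, hs'.map_identity u hu]
      change (0 : A'.E) + A'.d₂ 0 = 0
      simp
    | h_add r r' hr hr' =>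
      rw [map_add, map_add, ← hr, ← hr']
      simp only [SemiCarrier.add_snd, SemiCarrier.add_fst, map_add]
      abel
    | h_smul c r hr =>
      rw [map_smul, map_smul, ← hr]
      simp only [SemiCarrier.smul_snd, SemiCarrier.smul_fst, map_smul, smul_add]
    | h_mul r r' hr hr' =>
      rw [map_mul, hs'.map_mul, ← hr, ← hr', h.target₀, h.target₀, ← h1, ← h1, ← h2,
        ← h2]
      generalize F r = z
      generalize F r' = z'
      obtain ⟨⟨a, e⟩, ⟨e₁, l⟩⟩ := z
      obtain ⟨⟨a', e'⟩, ⟨e₁', l'⟩⟩ := z'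
      change (e * e₁' + A'.actE a e₁') + (e' * e₁ + A'.actE a' e₁) + e₁ * e₁'
        + A'.d₂ ((A'.actL (A'.d₁ e) l' + A'.actL a l' - A'.lift e₁' e)
          + (A'.actL (A'.d₁ e') l + A'.actL a' l - A'.lift e₁ e')
          + (A'.actEL e₁ l' + A'.actEL e₁' l + l * l'))
        = A'.actE (a + A'.d₁ e) (e₁' + A'.d₂ l') + A'.actE (a' + A'.d₁ e') (e₁ + A'.d₂ l)
          + (e₁ + A'.d₂ l) * (e₁' + A'.d₂ l')
      simp only [map_add, map_sub, LinearMap.add_apply, A'.d₂_act, A'.d₂_lift, A'.d₂_actEL,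
        _root_.map_mul, mul_add, add_mul, mul_comm e₁' e, mul_comm e₁ e', mul_comm (A'.d₂ l) e₁']
      abel
  refine ⟨{ toFun := fun r => (SemiCarrier.snd (F r : SemiCarrier A'.bullet)).snd
            map_add' := fun r r' => by rw [map_add]; rfl
            map_smul' := fun c r => by rw [map_smul]; rfl }, ⟨F, ?_⟩, ?_, ?_⟩
  · intro r
    apply SemiCarrier.ext <;> apply SemiCarrier.ext
    · exact h1 r
    · exact h2 r
    · exact eq_sub_of_add_eq (h3 r)
    · rfl
  · intro i
    change (SemiCarrier.snd (F (b.elt i) : SemiCarrier A'.bullet)).snd = 0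
    rw [hF]
  · intro u hu
    change (SemiCarrier.snd (F u : SemiCarrier A'.bullet)).snd = 0
    rw [hF' u hu]; rfl

/-- The map `w^(s,s') : R → L'` of two composable homotopies. -/
noncomputable def concatW (b : Basis A.R B) (h : Homotopy f g) (h' : Homotopy g k) :
    A.R →ₗ[κ] A'.L := (existsUnique_w b h h'.isDerivation).choose

lemma concatW_isW (b : Basis A.R B) (h : Homotopy f g) (h' : Homotopy g k) :
    IsW b f.f₀ h.s h'.s (concatW b h h') := (existsUnique_w b h h'.isDerivation).choose_spec.1

lemma concatS_eq (b : Basis A.R B) (h : Homotopy f g) (h' : Homotopy g k) (r : A.R) :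
    concatS b h h' r = h.s r + h'.s r - A'.d₂ (concatW b h h' r) := by
  have hw := concatW_isW b h h'
  have hd := concatS_isDerivation b h h'
  induction r using b.induction with
  | h_basis i => rw [concatS_elt, hw.elt]; simp
  | h_one u hu =>
    rw [hd.map_identity u hu, hw.map_identity u hu, h.isDerivation.map_identity u hu,
      h'.isDerivation.map_identity u hu]
    simp
  | h_add r r' hr hr' => simp only [map_add, hr, hr']; abel
  | h_smul c r hr => simp only [map_smul, hr, smul_sub, smul_add]
  | h_mul r r' hr hr' =>
    rw [hd.map_mul, hr, hr', h.isDerivation.map_mul, h'.isDerivation.map_mul, hw.map_mul,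
      h.target₀, h.target₀]
    simp only [map_add, map_sub, LinearMap.add_apply, A'.d₂_act, A'.d₂_lift,
      A'.d₂_actEL, _root_.map_mul, mul_add, add_mul, mul_sub, sub_mul]
    rw [mul_comm (h.s r') (A'.d₂ _), mul_comm (h'.s r') (A'.d₂ _), mul_comm (h'.s r') (h.s r),
      mul_comm (h'.s r) (h.s r')]
    abel

lemma actL_mul_comm (A : TwoCrossedModule.{u, v₀, v₁, v₂} κ) (r : A.R) (l l' : A.L) :
    l * A.actL r l' = A.actL r (l * l') := (A.actL.act_mul' r l l').symm

lemma actEL_mul_comm (A : TwoCrossedModule.{u, v₀, v₁, v₂} κ) (e : A.E) (l l' : A.L) :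
    l * A.actEL e l' = A.actEL e (l * l') := (A.actEL.act_mul' e l l').symm

/-- `t ⊞ t' = t + t' + w^(s,s') ∘ ∂₁`. -/
noncomputable def concatT (b : Basis A.R B) (h : Homotopy f g) (h' : Homotopy g k) :
    A.E →ₗ[κ] A'.L := h.t + h'.t + (concatW b h h').comp (A.d₁ : A.E →ₗ[κ] A.R)

lemma concatT_apply (b : Basis A.R B) (h : Homotopy f g) (h' : Homotopy g k) (e : A.E) :
    concatT b h h' e = h.t e + h'.t e + concatW b h h' (A.d₁ e) := rfl

/-- The (universal) computation behind concatenation and inversion of homotopies: products. -/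
lemma concat_mul_aux (A' : TwoCrossedModule.{u, w₀, w₁, w₂} κ)
    (ρ ρ' : A'.R) (x x' σ σ' τ τ' : A'.E) (t t' y y' w w' : A'.L)
    (hρ : ρ = A'.d₁ x) (hρ' : ρ' = A'.d₁ x') :
    (A'.lift σ x' + A'.lift σ' x + A'.actEL x t' + A'.actEL x' t + A'.actEL σ t' + A'.actEL σ' t
        + t * t')
      + (A'.lift τ (x' + σ' + A'.d₂ t') + A'.lift τ' (x + σ + A'.d₂ t)
        + A'.actEL (x + σ + A'.d₂ t) y' + A'.actEL (x' + σ' + A'.d₂ t') y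
        + A'.actEL τ y' + A'.actEL τ' y + y * y')
      + (A'.actL ρ w' + A'.actL ρ' w + A'.actEL (σ + τ) w' + A'.actEL (σ' + τ') w
        - A'.lift τ' σ - A'.lift τ σ' - w * w')
      = A'.lift (σ + τ - A'.d₂ w) x' + A'.lift (σ' + τ' - A'.d₂ w') x
        + A'.actEL x (t' + y' + w') + A'.actEL x' (t + y + w)
        + A'.actEL (σ + τ - A'.d₂ w) (t' + y' + w') + A'.actEL (σ' + τ' - A'.d₂ w') (t + y + w)
        + (t + y + w) * (t' + y' + w') := by
  subst hρ hρ'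
  simp only [map_add, map_sub, LinearMap.add_apply, LinearMap.sub_apply, A'.lift_d₂_left,
    A'.lift_d₂_right, A'.actEL_d₂, mul_add, add_mul, mul_comm t' _, mul_comm w' _]
  abel

/-- The (universal) computation behind concatenation and inversion of homotopies: actions. -/
lemma concat_act_aux (A' : TwoCrossedModule.{u, w₀, w₁, w₂} κ)
    (a ρ : A'.R) (p p' x σ τ : A'.E) (t y w w' : A'.L)
    (hρ : ρ = A'.d₁ x) :
    (A'.actL a t + A'.actL (A'.d₁ p) t + A'.lift p x - A'.lift x p - A'.lift σ p)
      + (A'.actL (a + A'.d₁ p) y + A'.actL (A'.d₁ p') y + A'.lift p' (x + σ + A'.d₂ t)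
        - A'.lift (x + σ + A'.d₂ t) p' - A'.lift τ p')
      + (A'.actL a w' + A'.actL ρ w + A'.actEL (p + p') w' + A'.actEL (σ + τ) w
        - A'.lift τ p - A'.lift p' σ - w * w')
      = A'.actL a (t + y + w') + A'.actL (A'.d₁ (p + p' - A'.d₂ w)) (t + y + w')
        + A'.lift (p + p' - A'.d₂ w) x - A'.lift x (p + p' - A'.d₂ w)
        - A'.lift (σ + τ - A'.d₂ w') (p + p' - A'.d₂ w) := by
  subst hρ
  simp only [map_add, map_sub, LinearMap.add_apply, LinearMap.sub_apply, A'.lift_d₂_left,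
    A'.lift_d₂_right, A'.actEL_d₂, A'.d₁_d₂, map_zero, LinearMap.zero_apply]
  abel

/-- The concatenation `(s, t) ⊞ (s', t') : f → k` of `(s, t) : f → g` and `(s', t') : g → k`. -/
noncomputable def Homotopy.concat (b : Basis A.R B) (h : Homotopy f g) (h' : Homotopy g k) :
    Homotopy f k where
  s := concatS b h h'
  t := concatT b h h'
  isQuadraticDerivation :=
    { isDerivation := concatS_isDerivation b h h'
      map_mul := fun e e' => by
        simp only [concatT_apply, concatS_eq, h.isQuadraticDerivation.map_mul,
          h'.isQuadraticDerivation.map_mul, map_mul, (concatW_isW b h h').map_mul, h.target₁]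
        exact concat_mul_aux A' _ _ _ _ _ _ _ _ _ _ _ _ _ _ (f.f₀_d₁ e) (f.f₀_d₁ e')
      map_act := fun r e => by
        simp only [concatT_apply, concatS_eq, h.isQuadraticDerivation.map_act,
          h'.isQuadraticDerivation.map_act, A.d₁_act, (concatW_isW b h h').map_mul, h.target₁,
          h.target₀]
        exact concat_act_aux A' _ _ _ _ _ _ _ _ _ _ _ (f.f₀_d₁ e) }
  target₀ r := by
    rw [h'.target₀, h.target₀, concatS_eq, map_sub, map_add, A'.d₁_d₂]; abel
  target₁ e := by
    rw [h'.target₁, h.target₁, concatS_eq, concatT_apply]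
    simp only [map_add]; abel
  target₂ l := by
    rw [h'.target₂, h.target₂, concatT_apply, A.d₁_d₂, map_zero]; abel

/-- The identity homotopy `(0, 0) : f → f`. -/
def Homotopy.zero (f : Map A A') : Homotopy f f where
  s := 0
  t := 0
  isQuadraticDerivation :=
    { isDerivation := ⟨by simp, by simp⟩
      map_mul := by simp
      map_act := by simp }
  target₀ := by simp
  target₁ := by simp
  target₂ := by simp

@[ext]
lemma Homotopy.ext' {h h' : Homotopy f g} (hs : ∀ r, h.s r = h'.s r) (ht : ∀ e, h.t e = h'.t e) :
    h = h' := Homotopy.ext (LinearMap.ext hs) (LinearMap.ext ht)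

lemma concatW_zero_left (b : Basis A.R B) (h : Homotopy f g) (r : A.R) :
    concatW b (Homotopy.zero f) h r = 0 := by
  have hw := concatW_isW b (Homotopy.zero f) h
  induction r using b.induction with
  | h_basis i => exact hw.elt i
  | h_one u hu => exact hw.map_identity u hu
  | h_add r r' hr hr' => rw [map_add, hr, hr', add_zero]
  | h_smul c r hr => rw [map_smul, hr, smul_zero]
  | h_mul r r' hr hr' => rw [hw.map_mul, hr, hr']; simp [Homotopy.zero]

lemma concatW_zero_right (b : Basis A.R B) (h : Homotopy f g) (r : A.R) :
    concatW b h (Homotopy.zero g) r = 0 := by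
  have hw := concatW_isW b h (Homotopy.zero g)
  induction r using b.induction with
  | h_basis i => exact hw.elt i
  | h_one u hu => exact hw.map_identity u hu
  | h_add r r' hr hr' => rw [map_add, hr, hr', add_zero]
  | h_smul c r hr => rw [map_smul, hr, smul_zero]
  | h_mul r r' hr hr' => rw [hw.map_mul, hr, hr']; simp [Homotopy.zero]

lemma zero_concat (b : Basis A.R B) (h : Homotopy f g) : (Homotopy.zero f).concat b h = h := by
  apply Homotopy.ext'
  · intro r
    change concatS b (Homotopy.zero f) h r = h.s r
    rw [concatS_eq, concatW_zero_left]; simp [Homotopy.zero]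
  · intro e
    change concatT b (Homotopy.zero f) h e = h.t e
    rw [concatT_apply, concatW_zero_left]; simp [Homotopy.zero]

lemma concat_zero (b : Basis A.R B) (h : Homotopy f g) : h.concat b (Homotopy.zero g) = h := by
  apply Homotopy.ext'
  · intro r
    change concatS b h (Homotopy.zero g) r = h.s r
    rw [concatS_eq, concatW_zero_right]; simp [Homotopy.zero]
  · intro e
    change concatT b h (Homotopy.zero g) e = h.t e
    rw [concatT_apply, concatW_zero_right]; simp [Homotopy.zero]

/-- The (universal) computation behind associativity. -/
lemma concat_assoc_aux (A' : TwoCrossedModule.{u, w₀, w₁, w₂} κ)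
    (a a' : A'.R) (p p' q q' m m' : A'.E) (w w' x x' y y' z z' : A'.L)
    (hz : z = w + x - y) (hz' : z' = w' + x' - y') :
    (A'.actL a w' + A'.actL a' w + A'.actEL (p + q) w' + A'.actEL (p' + q') w
        - A'.lift q' p - A'.lift q p' - w * w')
      + (A'.actL a x' + A'.actL a' x + A'.actEL (p + q - A'.d₂ w + m) x'
        + A'.actEL (p' + q' - A'.d₂ w' + m') x
        - A'.lift m' (p + q - A'.d₂ w) - A'.lift m (p' + q' - A'.d₂ w') - x * x')
      = (A'.actL a z' + A'.actL a' z + A'.actEL (p + (q + m - A'.d₂ y)) z'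
        + A'.actEL (p' + (q' + m' - A'.d₂ y')) z
        - A'.lift (q' + m' - A'.d₂ y') p - A'.lift (q + m - A'.d₂ y) p' - z * z')
      + (A'.actL (a + A'.d₁ p) y' + A'.actL (a' + A'.d₁ p') y + A'.actEL (q + m) y'
        + A'.actEL (q' + m') y - A'.lift m' q - A'.lift m q' - y * y') := by
  subst hz hz'
  simp only [map_add, map_sub, LinearMap.add_apply, LinearMap.sub_apply, A'.lift_d₂_left,
    A'.lift_d₂_right, A'.actEL_d₂, mul_add, add_mul, mul_sub, sub_mul, mul_comm w' _,
    mul_comm y' _]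
  abel

variable {l : Map A A'}

lemma concatW_assoc (b : Basis A.R B) (h : Homotopy f g) (h' : Homotopy g k)
    (h'' : Homotopy k l) (r : A.R) :
    concatW b h h' r + concatW b (h.concat b h') h'' r
      = concatW b h (h'.concat b h'') r + concatW b h' h'' r := by
  have hw := concatW_isW b h h'
  have hx := concatW_isW b (h.concat b h') h''
  have hy := concatW_isW b h' h''
  have hz := concatW_isW b h (h'.concat b h'')
  induction r using b.induction with
  | h_basis i => rw [hw.elt, hx.elt, hy.elt, hz.elt]
  | h_one u hu =>
    rw [hw.map_identity u hu, hx.map_identity u hu, hy.map_identity u hu, hz.map_identity u hu]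
  | h_add r r' hr hr' =>
    simp only [map_add]
    rw [add_add_add_comm, hr, hr']; abel
  | h_smul c r hr => simp only [map_smul, ← smul_add, hr]
  | h_mul r r' hr hr' =>
    rw [hw.map_mul, hx.map_mul, hy.map_mul, hz.map_mul, h.target₀, h.target₀]
    change _ + (A'.actL (f.f₀ r) _ + A'.actL (f.f₀ r') _ + A'.actEL (concatS b h h' r + _) _
      + A'.actEL (concatS b h h' r' + _) _ - A'.lift _ (concatS b h h' r)
      - A'.lift _ (concatS b h h' r') - _) = (A'.actL (f.f₀ r) _ + A'.actL (f.f₀ r') _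
      + A'.actEL (_ + concatS b h' h'' r) _
      + A'.actEL (_ + concatS b h' h'' r') _ - A'.lift (concatS b h' h'' r') _
      - A'.lift (concatS b h' h'' r) _ - _) + _
    simp only [concatS_eq b h h', concatS_eq b h' h'']
    exact concat_assoc_aux A' _ _ _ _ _ _ _ _ _ _ _ _ _ _ _ _ (eq_sub_of_add_eq hr.symm)
      (eq_sub_of_add_eq hr'.symm)

lemma concat_assoc (b : Basis A.R B) (h : Homotopy f g) (h' : Homotopy g k)
    (h'' : Homotopy k l) : (h.concat b h').concat b h'' = h.concat b (h'.concat b h'') := by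
  have hW := concatW_assoc b h h' h''
  apply Homotopy.ext'
  · intro r
    change concatS b (h.concat b h') h'' r = concatS b h (h'.concat b h'') r
    rw [concatS_eq, concatS_eq]
    change concatS b h h' r + _ - _ = _ + concatS b h' h'' r - _
    rw [concatS_eq, concatS_eq]
    have := congrArg A'.d₂ (hW r)
    simp only [map_add] at this
    rw [← sub_eq_zero] at this ⊢
    rw [← neg_eq_zero, ← this]
    abel
  · intro e
    change concatT b (h.concat b h') h'' e = concatT b h (h'.concat b h'') e
    rw [concatT_apply, concatT_apply]
    change concatT b h h' e + _ + _ = _ + concatT b h' h'' e + _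
    rw [concatT_apply, concatT_apply]
    have := hW (A.d₁ e)
    rw [← sub_eq_zero] at this ⊢
    rw [← this]
    abel

/-- There is a unique `g₀`-derivation which agrees with `-s` on the basis. -/
lemma existsUnique_invS (b : Basis A.R B) (h : Homotopy f g) :
    ∃! s : A.R →ₗ[κ] A'.E, IsDerivation g.f₀ s ∧ ∀ i, s (b.elt i) = - h.s (b.elt i) := by
  refine existsUnique_derivation b g.f₀ (fun i => - h.s (b.elt i)) ?_
  intro u hu i
  rw [map_neg, h.target_identity u hu, h.isDerivation.act_identity u hu]

lemma exists_concat_eq_zero (b : Basis A.R B) (h : Homotopy f g) :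
    ∃ j : Homotopy g f, h.concat b j = Homotopy.zero f := by
  obtain ⟨s, ⟨hs, hsb⟩, -⟩ := existsUnique_invS b h
  obtain ⟨w, hw, hwu⟩ := existsUnique_w b h hs
  have h0 : ∀ r, h.s r + s r - A'.d₂ (w r) = 0 := by
    intro r
    induction r using b.induction with
    | h_basis i => rw [hsb, hw.elt]; simp
    | h_one u hu =>
      rw [hw.map_identity u hu, h.isDerivation.map_identity u hu, hs.map_identity u hu]
      simp
    | h_add r r' hr hr' =>
      rw [map_add, map_add, map_add, map_add, ← add_zero (0 : A'.E)]
      nth_rewrite 1 [← hr]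
      rw [← hr']
      abel
    | h_smul c r hr => rw [map_smul, map_smul, map_smul, map_smul, ← smul_add, ← smul_sub, hr,
        smul_zero]
    | h_mul r r' hr hr' =>
      have e1 : s r = A'.d₂ (w r) - h.s r := by
        rw [eq_sub_iff_add_eq, add_comm]; exact sub_eq_zero.mp hr
      have e2 : s r' = A'.d₂ (w r') - h.s r' := by
        rw [eq_sub_iff_add_eq, add_comm]; exact sub_eq_zero.mp hr'
      rw [hs.map_mul, h.isDerivation.map_mul, hw.map_mul, h.target₀, h.target₀, e1, e2]
      simp only [map_add, map_sub, LinearMap.add_apply, LinearMap.sub_apply, A'.d₂_act, A'.d₂_lift,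
        A'.d₂_actEL, _root_.map_mul, mul_sub, sub_mul]
      simp only [mul_comm (h.s r') (h.s r), mul_comm (h.s r') (A'.d₂ (w r)),
        mul_comm (A'.d₂ (w r')) (h.s r), mul_comm (A'.d₂ (w r')) (A'.d₂ (w r))]
      abel
  let t : A.E →ₗ[κ] A'.L := - h.t - w.comp (A.d₁ : A.E →ₗ[κ] A.R)
  have ht : ∀ e, t e = - h.t e - w (A.d₁ e) := fun e => rfl
  have ht0 : ∀ e, h.t e + t e + w (A.d₁ e) = 0 := fun e => by rw [ht]; abel
  let j : Homotopy g f :=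
    { s := s
      t := t
      isQuadraticDerivation :=
        { isDerivation := hs
          map_mul := fun e e' => by
            have key := concat_mul_aux A' _ _ (f.f₁ e) (f.f₁ e') (h.s (A.d₁ e)) (h.s (A.d₁ e'))
              (s (A.d₁ e)) (s (A.d₁ e')) (h.t e) (h.t e') (t e) (t e') (w (A.d₁ e)) (w (A.d₁ e'))
              (f.f₀_d₁ e) (f.f₀_d₁ e')
            rw [← h.isQuadraticDerivation.map_mul, ← hw.map_mul, ← _root_.map_mul A.d₁] at key
            simp only [h0, ht0, map_zero, LinearMap.zero_apply, zero_mul, add_zero] at key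
            rw [← h.target₁, ← h.target₁] at key
            rw [ht, ← sub_eq_zero, ← neg_eq_zero, ← key]
            abel
          map_act := fun r e => by
            have key := concat_act_aux A' (f.f₀ r) _ (h.s r) (s r) (f.f₁ e) (h.s (A.d₁ e))
              (s (A.d₁ e)) (h.t e) (t e) (w r) (w (A.d₁ e)) (f.f₀_d₁ e)
            rw [← h.isQuadraticDerivation.map_act, ← hw.map_mul, ← A.d₁_act, ← h.target₁,
              ← h.target₀] at key
            simp only [h0, ht0, map_zero, LinearMap.zero_apply, add_zero, sub_zero] at key
            rw [ht, ← sub_eq_zero, ← neg_eq_zero, ← key]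
            abel }
      target₀ := fun r => by
        have := congrArg A'.d₁ (h0 r)
        simp only [map_add, map_sub, A'.d₁_d₂, map_zero, sub_zero] at this
        rw [h.target₀, add_assoc, this, add_zero]
      target₁ := fun e => by
        rw [h.target₁, ht, ← sub_eq_zero, ← neg_eq_zero, ← h0 (A.d₁ e)]
        simp only [map_sub, map_neg]
        abel
      target₂ := fun l => by
        rw [h.target₂, ht, A.d₁_d₂, map_zero]; abel }
  have hwj : concatW b h j = w := hwu _ (concatW_isW b h j) |>.trans rfl
  refine ⟨j, Homotopy.ext' (fun r => ?_) (fun e => ?_)⟩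
  · change concatS b h j r = 0
    rw [concatS_eq, hwj]
    exact h0 r
  · change concatT b h j e = 0
    rw [concatT_apply, hwj]
    exact ht0 e

/-- The homotopy inverse to `h` with respect to concatenation. -/
noncomputable def Homotopy.inverse (b : Basis A.R B) (h : Homotopy f g) : Homotopy g f :=
  (exists_concat_eq_zero b h).choose

lemma concat_inverse (b : Basis A.R B) (h : Homotopy f g) :
    h.concat b (h.inverse b) = Homotopy.zero f := (exists_concat_eq_zero b h).choose_spec

lemma inverse_concat (b : Basis A.R B) (h : Homotopy f g) :
    (h.inverse b).concat b h = Homotopy.zero g := by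
  have h1 : (h.inverse b).inverse b = h := by
    rw [← zero_concat b ((h.inverse b).inverse b), ← concat_inverse b h, concat_assoc,
      concat_inverse, concat_zero]
  have h2 := concat_inverse b (h.inverse b)
  rwa [h1] at h2

/-- The type of objects of the groupoid `HOM(A, A')`: the 2-crossed module maps `A → A'`.  The
groupoid structure depends on the chosen basis `b`. -/
@[nolint unusedArguments]
def HOM (_b : Basis A.R B) (A' : TwoCrossedModule.{u, w₀, w₁, w₂} κ) := Map A A'

/-- The groupoid `HOM(A, A')` of 2-crossed module maps and their homotopies. -/
noncomputable instance (b : Basis A.R B) : Groupoid (HOM b A') where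
  Hom f g := Homotopy (A := A) (A' := A') f g
  id f := Homotopy.zero (A := A) (A' := A') f
  comp h h' := Homotopy.concat b h h'
  id_comp h := zero_concat b h
  comp_id h := concat_zero b h
  assoc h h' h'' := concat_assoc b h h' h''
  inv h := Homotopy.inverse b h
  inv_comp h := inverse_concat b h
  comp_inv h := concat_inverse b h

/-- A homotopy `u : f → g`, regarded as an arrow of the groupoid `HOM(A, A')`. -/
def Homotopy.arrow (b : Basis A.R B) (u : Homotopy f g) :
    Quiver.Hom (V := HOM b A') f g := u

/-- `q : R → L'` is a quadratic 2-derivation over `f₀` and the derivation `s`: a linear map such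
that `r ↦ (f₀ r, s r, q r)` is an algebra map `R → (R' ⋉ E') ⋉ L'`.  If `R` has an identity
element `1`, then also `q 1 = 0`. -/
structure IsTwoDerivation (f₀ : A.R →ₙₐ[κ] A'.R) (s : A.R →ₗ[κ] A'.E) (q : A.R →ₗ[κ] A'.L) :
    Prop where
  map_mul : ∀ r r', q (r * r') = A'.actL (f₀ r) (q r') + A'.actL (f₀ r') (q r)
    + A'.actEL (s r) (q r') + A'.actEL (s r') (q r) + q r * q r'
  map_identity : ∀ u, IsIdentity A.R u → q u = 0

/-- A 2-fold homotopy between homotopies `(s, t), (s', t') : f → g`: a quadratic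
`(f, s, t)`-2-derivation `q` with `s' = s + ∂₂ ∘ q` and `t' = t - q ∘ ∂₁`. -/
@[ext]
structure TwoHomotopy (h h' : Homotopy f g) where
  q : A.R →ₗ[κ] A'.L
  isTwoDerivation : IsTwoDerivation f.f₀ h.s q
  target_s : ∀ r, h'.s r = h.s r + A'.d₂ (q r)
  target_t : ∀ e, h'.t e = h.t e - q (A.d₁ e)

/-- The groupoid `HOM₂(A, A', f, g)` of homotopies `f → g` and their 2-fold homotopies, with
composition `q ⋆ q' = q + q'`, identities `0` and inverses `-q`. -/
instance : Groupoid (Homotopy f g) where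
  Hom h h' := TwoHomotopy h h'
  id h :=
    { q := 0
      isTwoDerivation := ⟨by simp, by simp⟩
      target_s := by simp
      target_t := by simp }
  comp {h h' h''} q q' :=
    { q := q.q + q'.q
      isTwoDerivation :=
        { map_mul := fun r r' => by
            simp only [LinearMap.add_apply, q.isTwoDerivation.map_mul, q'.isTwoDerivation.map_mul,
              q.target_s, map_add, A'.actEL_d₂, mul_add, add_mul, mul_comm (q.q r') (q'.q r)]
            abel
          map_identity := fun u hu => by
            simp [q.isTwoDerivation.map_identity u hu, q'.isTwoDerivation.map_identity u hu] }
      target_s := fun r => by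
        rw [q'.target_s, q.target_s, LinearMap.add_apply, map_add, add_assoc]
      target_t := fun e => by
        rw [q'.target_t, q.target_t, LinearMap.add_apply]; abel }
  id_comp q := TwoHomotopy.ext (zero_add q.q)
  comp_id q := TwoHomotopy.ext (add_zero q.q)
  assoc q q' q'' := TwoHomotopy.ext (add_assoc q.q q'.q q''.q)
  inv {h h'} q :=
    { q := - q.q
      isTwoDerivation :=
        { map_mul := fun r r' => by
            simp only [LinearMap.neg_apply, q.isTwoDerivation.map_mul, q.target_s, map_add,
              LinearMap.add_apply, map_neg, A'.actEL_d₂, mul_comm (q.q r') (q.q r), neg_mul_neg]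
            abel
          map_identity := fun u hu => by
            simp [q.isTwoDerivation.map_identity u hu] }
      target_s := fun r => by
        rw [q.target_s, LinearMap.neg_apply, map_neg]; abel
      target_t := fun e => by
        rw [q.target_t, LinearMap.neg_apply]; abel }
  inv_comp q := TwoHomotopy.ext (neg_add_cancel q.q)
  comp_inv q := TwoHomotopy.ext (add_neg_cancel q.q)

/-- A quadratic 2-derivation is determined by its values on a basis. -/
lemma IsTwoDerivation.eq_of_basis (b : Basis A.R B) {f₀ : A.R →ₙₐ[κ] A'.R}
    {s : A.R →ₗ[κ] A'.E} {q q' : A.R →ₗ[κ] A'.L} (hq : IsTwoDerivation f₀ s q)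
    (hq' : IsTwoDerivation f₀ s q') (h : ∀ i, q (b.elt i) = q' (b.elt i)) : q = q' := by
  refine LinearMap.ext fun r => ?_
  induction r using b.induction with
  | h_basis i => exact h i
  | h_one u hu => rw [hq.map_identity u hu, hq'.map_identity u hu]
  | h_add r r' hr hr' => rw [map_add, map_add, hr, hr']
  | h_smul c r hr => rw [map_smul, map_smul, hr]
  | h_mul r r' hr hr' => rw [hq.map_mul, hq'.map_mul, hr, hr']

/-- The (universal) computation behind right whiskering. -/
lemma whisker_aux (A' : TwoCrossedModule.{u, w₀, w₁, w₂} κ)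
    (a a' : A'.R) (p p' m m' : A'.E) (q q' w w' z z' : A'.L) :
    (A'.actL a q' + A'.actL a' q + A'.actEL p q' + A'.actEL p' q + q * q')
      + (A'.actL a w' + A'.actL a' w + A'.actEL (p + m) w' + A'.actEL (p' + m') w
        - A'.lift m' p - A'.lift m p' - w * w')
      - (A'.actL a z' + A'.actL a' z + A'.actEL (p + A'.d₂ q + m) z'
        + A'.actEL (p' + A'.d₂ q' + m') z
        - A'.lift m' (p + A'.d₂ q) - A'.lift m (p' + A'.d₂ q') - z * z')
      = A'.actL a (q' + w' - z') + A'.actL a' (q + w - z)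
        + A'.actEL (p + m - A'.d₂ w) (q' + w' - z') + A'.actEL (p' + m' - A'.d₂ w') (q + w - z)
        + (q + w - z) * (q' + w' - z') := by
  simp only [map_add, map_sub, LinearMap.add_apply, LinearMap.sub_apply,
    A'.lift_d₂_right, A'.actEL_d₂, mul_add, add_mul, mul_sub, sub_mul, mul_comm q' _,
    mul_comm w' _]
  abel

lemma isTwoDerivation_formula (b : Basis A.R B) {h h' : Homotopy f g} (q : TwoHomotopy h h')
    (u : Homotopy g k) :
    IsTwoDerivation f.f₀ (concatS b h u) (q.q + concatW b h u - concatW b h' u) where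
  map_mul r r' := by
    simp only [LinearMap.add_apply, LinearMap.sub_apply, q.isTwoDerivation.map_mul,
      (concatW_isW b h u).map_mul, (concatW_isW b h' u).map_mul, concatS_eq, q.target_s]
    exact whisker_aux A' _ _ _ _ _ _ _ _ _ _ _ _
  map_identity v hv := by
    simp [q.isTwoDerivation.map_identity v hv, (concatW_isW b h u).map_identity v hv,
      (concatW_isW b h' u).map_identity v hv]

/-- There is a unique quadratic `(f, s ⊞ u, t ⊞ v)`-2-derivation which agrees with `q` on the
basis. -/
lemma existsUnique_whisker (b : Basis A.R B) {h h' : Homotopy f g} (q : TwoHomotopy h h')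
    (u : Homotopy g k) :
    ∃! p : A.R →ₗ[κ] A'.L, IsTwoDerivation f.f₀ (h.concat b u).s p ∧
      ∀ i, p (b.elt i) = q.q (b.elt i) := by
  refine ⟨_, ⟨isTwoDerivation_formula b q u, fun i => ?_⟩,
    fun p hp => hp.1.eq_of_basis b (isTwoDerivation_formula b q u) fun i => ?_⟩
  · simp [(concatW_isW b h u).elt, (concatW_isW b h' u).elt]
  · simp [(concatW_isW b h u).elt, (concatW_isW b h' u).elt, hp.2]

/-- The linear map `q ⊚ u : R → L'`: the unique quadratic `(f, s ⊞ u, t ⊞ v)`-2-derivation which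
agrees with `q` on the basis. -/
noncomputable def whiskerMap (b : Basis A.R B) {h h' : Homotopy f g} (q : TwoHomotopy h h')
    (u : Homotopy g k) : A.R →ₗ[κ] A'.L := (existsUnique_whisker b q u).choose

lemma whiskerMap_eq (b : Basis A.R B) {h h' : Homotopy f g} (q : TwoHomotopy h h')
    (u : Homotopy g k) : whiskerMap b q u = q.q + concatW b h u - concatW b h' u := by
  have hp := (existsUnique_whisker b q u).choose_spec.1
  refine hp.1.eq_of_basis b (isTwoDerivation_formula b q u) fun i => ?_
  rw [hp.2]
  simp [(concatW_isW b h u).elt, (concatW_isW b h' u).elt]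

/-- Right whiskering: the 2-fold homotopy `q ⊚ u` from `(s, t) ⊞ (u, v)` to `(s', t') ⊞ (u, v)`. -/
noncomputable def TwoHomotopy.whisker (b : Basis A.R B) {h h' : Homotopy f g}
    (q : TwoHomotopy h h') (u : Homotopy g k) : TwoHomotopy (h.concat b u) (h'.concat b u) where
  q := whiskerMap b q u
  isTwoDerivation := (existsUnique_whisker b q u).choose_spec.1.1
  target_s r := by
    change concatS b h' u r = concatS b h u r + _
    rw [whiskerMap_eq, concatS_eq, concatS_eq, q.target_s]
    simp only [LinearMap.add_apply, LinearMap.sub_apply, map_add, map_sub]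
    abel
  target_t e := by
    change concatT b h' u e = concatT b h u e - _
    rw [whiskerMap_eq, concatT_apply, concatT_apply, q.target_t]
    simp only [LinearMap.add_apply, LinearMap.sub_apply]
    abel

/-- Right whiskering by `u : g → k`, on objects `h ↦ h ⊞ u` and on arrows `q ↦ q ⊚ u`, as a map of
the underlying graphs of the groupoids `HOM₂(A, A', f, g)` and `HOM₂(A, A', f, k)`. -/
noncomputable def whiskerGraph (b : Basis A.R B) (f : Map A A') (u : Homotopy g k) :
    Homotopy f g ⥤q Homotopy f k where
  obj h := h.concat b u
  map q := TwoHomotopy.whisker b q u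

/-- The groupoid `HOM₂(A, A')₁`, the disjoint union of all the groupoids `HOM₂(A, A', f, g)`. -/
abbrev HOM₂ (A : TwoCrossedModule.{u, v₀, v₁, v₂} κ) (A' : TwoCrossedModule.{u, w₀, w₁, w₂} κ) :=
  Σ p : Map A A' × Map A A', Homotopy p.1 p.2

end Homotopies

end TwoCrossedModule

/-- A disjoint union of groupoids is a groupoid. -/
instance sigmaGroupoid {I : Type*} (C : I → Type*) [∀ i, Groupoid (C i)] :
    Groupoid (Σ i, C i) where
  inv
    | Sigma.SigmaHom.mk q => Sigma.SigmaHom.mk (Groupoid.inv q)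
  inv_comp
    | Sigma.SigmaHom.mk q => congrArg Sigma.SigmaHom.mk (Groupoid.inv_comp q)
  comp_inv
    | Sigma.SigmaHom.mk q => congrArg Sigma.SigmaHom.mk (Groupoid.comp_inv q)

/-- The fibre over `g` of an anchor map `X → G`: a full subgroupoid of `X`. -/
abbrev AnchorFiber {G X : Type*} [Groupoid X] (anchor : X → G) (g : G) :=
  ObjectProperty.FullSubcategory (fun x : X => anchor x = g)

/-- A right action, by groupoid maps, of the groupoid `G` on the groupoid `X`, along an anchor map
`X → G` which is constant on arrows: every arrow `u : g ⟶ h` of `G` acts as a functor from the part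
of `X` over `g` to the part of `X` over `h`, compatibly with identities and composition. -/
structure RightGroupoidAction (G X : Type*) [Groupoid G] [Groupoid X] (anchor : X → G) where
  anchor_eq : ∀ {x y : X}, (x ⟶ y) → anchor x = anchor y
  act : ∀ {g h : G}, (g ⟶ h) → (AnchorFiber anchor g ⥤ AnchorFiber anchor h)
  act_id : ∀ g : G, act (𝟙 g) = 𝟭 _
  act_comp : ∀ {g h k : G} (u : g ⟶ h) (m : h ⟶ k), act (u ≫ m) = act u ⋙ act m

namespace TwoCrossedModule

variable {κ : Type u} [CommRing κ] {A : TwoCrossedModule.{u, v₀, v₁, v₂} κ}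
  {A' : TwoCrossedModule.{u, w₀, w₁, w₂} κ} {B : Type x}

/-- The anchor map `HOM₂(A, A')₁ → HOM(A, A')`, which sends a homotopy `f → g` to `g`. -/
def anchor (b : Basis A.R B) (A' : TwoCrossedModule.{u, w₀, w₁, w₂} κ) (z : HOM₂ A A') :
    HOM b A' := z.1.2

/-- The inclusion of `HOM₂(A, A', f, g)` into the part of `HOM₂(A, A')₁` over `g`. -/
def inclFiber (b : Basis A.R B) (f g : Map A A') :
    Homotopy f g ⥤ AnchorFiber (anchor b A') g where
  obj h := ⟨⟨(f, g), h⟩, rfl⟩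
  map q := ObjectProperty.homMk (Sigma.SigmaHom.mk q)

end TwoCrossedModule

/-!
The whiskered 2-fold homotopy has the closed form `q ⊚ u = q + w^(s,u) - w^(s',u)` for
`q : (s, t) ⇒ (s', t')`: both sides are quadratic 2-derivations which agree on the basis
(`whiskerMap_eq`).  All the laws of the action follow from it.

* Additivity in `q` is a telescoping sum, and identities whisker to identities.
* `w^(s,0) = 0`, so that an identity homotopy acts trivially.
* The cocycle identity `w^(s,u) + w^(s ⊞ u, m) = w^(s, u ⊞ m) + w^(u,m)` (`concatW_assoc`), applied
  to `s` and to `s'`, gives `q ⊚ (u ⊞ m) = (q ⊚ u) ⊚ m`: the term `w^(u,m)` does not depend on the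
  source homotopy, so it cancels.

The functors making up the action agree on objects only up to the propositional equalities
`h ⊞ 0 = h` and `(h ⊞ u) ⊞ m = h ⊞ (u ⊞ m)`, so their arrows are compared by heterogeneous
equality; `heq_fiberHom` reduces this to an equality of the underlying linear maps `R → L'`.
-/

namespace TwoCrossedModule

section Whiskering

variable {κ : Type u} [CommRing κ] {A : TwoCrossedModule.{u, v₀, v₁, v₂} κ}
  {A' : TwoCrossedModule.{u, w₀, w₁, w₂} κ} {B : Type x} {f g k l : Map A A'}

lemma id_q (h : Homotopy f g) : TwoHomotopy.q (𝟙 h) = 0 := rfl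

lemma comp_q {h h' h'' : Homotopy f g} (q : h ⟶ h') (q' : h' ⟶ h'') :
    TwoHomotopy.q (q ≫ q') = TwoHomotopy.q q + TwoHomotopy.q q' := rfl

lemma whisker_q (b : Basis A.R B) {h h' : Homotopy f g} (q : h ⟶ h') (u : Homotopy g k) :
    (TwoHomotopy.whisker b q u).q = TwoHomotopy.q q + concatW b h u - concatW b h' u :=
  whiskerMap_eq b q u

lemma whisker_id_q (b : Basis A.R B) (h : Homotopy f g) (u : Homotopy g k) :
    (TwoHomotopy.whisker b (𝟙 h) u).q = 0 := by
  rw [whisker_q, id_q, zero_add, sub_self]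

lemma whisker_comp_q (b : Basis A.R B) {h h' h'' : Homotopy f g} (q : h ⟶ h') (q' : h' ⟶ h'')
    (u : Homotopy g k) :
    (TwoHomotopy.whisker b (q ≫ q') u).q =
      (TwoHomotopy.whisker b q u).q + (TwoHomotopy.whisker b q' u).q := by
  rw [whisker_q, whisker_q, whisker_q, comp_q]
  abel

lemma whisker_zero_q (b : Basis A.R B) {h h' : Homotopy f g} (q : h ⟶ h') :
    (TwoHomotopy.whisker b q (Homotopy.zero g)).q = TwoHomotopy.q q := by
  ext r
  simp [whisker_q, concatW_zero_right]

lemma whisker_concat_q (b : Basis A.R B) {h h' : Homotopy f g} (q : h ⟶ h')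
    (u : Homotopy g k) (m : Homotopy k l) :
    (TwoHomotopy.whisker b q (u.concat b m)).q =
      (TwoHomotopy.whisker b (TwoHomotopy.whisker b q u) m).q := by
  ext r
  have e := concatW_assoc b h u m r
  have e' := concatW_assoc b h' u m r
  rw [whisker_q b q, whisker_q b (h := h.concat b u) (h' := h'.concat b u), whisker_q b q]
  simp only [LinearMap.add_apply, LinearMap.sub_apply]
  rw [← eq_sub_iff_add_eq] at e e'
  rw [e, e']
  abel

/-- Right whiskering by `u : g → k`, as a functor `HOM₂(A, A', f, g) ⥤ HOM₂(A, A', f, k)`. -/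
noncomputable def whiskerFunctor (b : Basis A.R B) (f : Map A A') (u : Homotopy g k) :
    Homotopy f g ⥤ Homotopy f k where
  obj := (whiskerGraph b f u).obj
  map q := (whiskerGraph b f u).map q
  map_id h := TwoHomotopy.ext (whisker_id_q b h u)
  map_comp q q' := TwoHomotopy.ext (whisker_comp_q b q q' u)

/-- The effect on objects of right whiskering by `u : g → k`, from the part of `HOM₂(A, A')₁` over
`g` to the part over `k`. -/
noncomputable def fiberObj (b : Basis A.R B) (u : Homotopy g k) :
    AnchorFiber (anchor b A') g → AnchorFiber (anchor b A') k
  | ⟨⟨(f, _), h⟩, rfl⟩ => (inclFiber b f k).obj ((whiskerFunctor b f u).obj h)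

/-- The effect on arrows of right whiskering by `u : g → k`.  An arrow of the disjoint union lies in
a single summand `HOM₂(A, A', f, g)`, where it is whiskered. -/
noncomputable def fiberMap (b : Basis A.R B) (u : Homotopy g k) :
    {y z : AnchorFiber (anchor b A') g} → (y ⟶ z) → (fiberObj b u y ⟶ fiberObj b u z)
  | ⟨⟨(f, _), _⟩, rfl⟩, ⟨_, _⟩, ⟨Sigma.SigmaHom.mk q⟩ =>
    (inclFiber b f k).map ((whiskerFunctor b f u).map q)

/-- Right whiskering by `u : g → k`, as a functor from the part of `HOM₂(A, A')₁` over `g` to the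
part over `k`. -/
noncomputable def fiberFunctor (b : Basis A.R B) (u : Homotopy g k) :
    AnchorFiber (anchor b A') g ⥤ AnchorFiber (anchor b A') k where
  obj := fiberObj b u
  map := fiberMap b u
  map_id := by
    rintro ⟨⟨⟨f, g'⟩, h⟩, hg⟩
    obtain rfl : g' = _ := hg
    exact (whiskerFunctor b f u ⋙ inclFiber b f k).map_id h
  map_comp := by
    rintro ⟨⟨⟨f, g'⟩, h⟩, hg⟩ ⟨_, _⟩ ⟨_, _⟩ ⟨⟨q⟩⟩ ⟨⟨q'⟩⟩
    obtain rfl : g' = _ := hg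
    exact (whiskerFunctor b f u ⋙ inclFiber b f k).map_comp q q'

/-- Arrows of the part of `HOM₂(A, A')₁` over `g` are heterogeneously equal as soon as their ends
and their underlying linear maps `R → L'` are equal. -/
lemma heq_fiberHom (b : Basis A.R B) {h h' j j' : Homotopy f g} (q : h ⟶ h') (p : j ⟶ j')
    (hj : h = j) (hj' : h' = j') (e : TwoHomotopy.q q = TwoHomotopy.q p) :
    HEq ((inclFiber b f g).map q) ((inclFiber b f g).map p) := by
  subst hj hj'
  rw [show q = p from TwoHomotopy.ext e]

lemma fiberFunctor_zero (b : Basis A.R B) (g : Map A A') :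
    fiberFunctor b (Homotopy.zero g) = 𝟭 (AnchorFiber (anchor b A') g) := by
  refine Functor.hext ?_ ?_
  · rintro ⟨⟨⟨f, g'⟩, h⟩, hg⟩
    obtain rfl : g' = _ := hg
    exact congrArg (inclFiber b f _).obj (concat_zero b h)
  · rintro ⟨⟨⟨f, g'⟩, h⟩, hg⟩ ⟨_, _⟩ ⟨⟨q⟩⟩
    obtain rfl : g' = _ := hg
    exact heq_fiberHom b _ q (concat_zero b _) (concat_zero b _) (whisker_zero_q b q)

lemma fiberFunctor_concat (b : Basis A.R B) (u : Homotopy g k) (m : Homotopy k l) :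
    fiberFunctor b (u.concat b m) = fiberFunctor b u ⋙ fiberFunctor b m := by
  refine Functor.hext ?_ ?_
  · rintro ⟨⟨⟨f, g'⟩, h⟩, hg⟩
    obtain rfl : g' = _ := hg
    exact congrArg (inclFiber b f l).obj (concat_assoc b h u m).symm
  · rintro ⟨⟨⟨f, g'⟩, h⟩, hg⟩ ⟨_, _⟩ ⟨⟨q⟩⟩
    obtain rfl : g' = _ := hg
    exact heq_fiberHom b _ _ (concat_assoc b _ u m).symm (concat_assoc b _ u m).symm
      (whisker_concat_q b q u m)

/-- The right action of `HOM(A, A')` on `HOM₂(A, A')₁` by right whiskering. -/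
noncomputable def whiskerAction (b : Basis A.R B) (A' : TwoCrossedModule.{u, w₀, w₁, w₂} κ) :
    RightGroupoidAction (HOM b A') (HOM₂ A A') (anchor b A') where
  anchor_eq := by
    rintro _ _ ⟨_⟩
    rfl
  act u := fiberFunctor b u
  act_id g := fiberFunctor_zero b g
  act_comp u m := fiberFunctor_concat b u m

end Whiskering

end TwoCrossedModule

theorem mainTheorem6 {κ : Type u} [CommRing κ]
    (A : TwoCrossedModule.{u, v₀, v₁, v₂} κ) (A' : TwoCrossedModule.{u, w₀, w₁, w₂} κ)
    {B : Type x} (b : TwoCrossedModule.Basis A.R B) :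
    (∃ Φ : RightGroupoidAction (TwoCrossedModule.HOM b A') (TwoCrossedModule.HOM₂ A A')
        (TwoCrossedModule.anchor b A'),
      ∀ (f g k : TwoCrossedModule.Map A A') (u : TwoCrossedModule.Homotopy g k),
        (TwoCrossedModule.inclFiber b f g).toPrefunctor ⋙q
            (Φ.act (TwoCrossedModule.Homotopy.arrow b u)).toPrefunctor =
          TwoCrossedModule.whiskerGraph b f u ⋙q
            (TwoCrossedModule.inclFiber b f k).toPrefunctor) ∧
    (∀ {f g k : TwoCrossedModule.Map A A'} {h h' h'' : TwoCrossedModule.Homotopy f g}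
        (q : h ⟶ h') (q' : h' ⟶ h'') (u : TwoCrossedModule.Homotopy g k) (r : A.R),
      (TwoCrossedModule.TwoHomotopy.whisker b (q ≫ q') u).q r =
        (TwoCrossedModule.TwoHomotopy.whisker b q u).q r +
          (TwoCrossedModule.TwoHomotopy.whisker b q' u).q r) ∧
    (∀ {f g k l : TwoCrossedModule.Map A A'} {h h' : TwoCrossedModule.Homotopy f g}
        (q : h ⟶ h') (u : TwoCrossedModule.Homotopy g k) (m : TwoCrossedModule.Homotopy k l)
        (r : A.R),
      (TwoCrossedModule.TwoHomotopy.whisker b q (u.concat b m)).q r =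
        (TwoCrossedModule.TwoHomotopy.whisker b
          (TwoCrossedModule.TwoHomotopy.whisker b q u) m).q r) := by
  exact ⟨⟨TwoCrossedModule.whiskerAction b A', fun _ _ _ _ => rfl⟩,
    fun q q' u r => LinearMap.congr_fun (TwoCrossedModule.whisker_comp_q b q q' u) r,
    fun q u m r => LinearMap.congr_fun (TwoCrossedModule.whisker_concat_q b q u m) r⟩
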